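/- Let $G$ be a (discrete) group. A family of subgroups of $G$ is a collection $\mathcal F$ of subgroups of $G$ that is closed under conjugation and under taking subgroups; the family generated by a collection $\mathcal P$ of subgroups is the smallest family containing $\mathcal P$. A $G$-CW-complex is a CW-complex together with a cellular action of $G$ (by homeomorphisms permuting the open $n$-cells for each $n$) such that a group element which fixes a cell setwise fixes it pointwise. A model for $E_{\mathcal F}G$ is a $G$-CW-complex $X$ such that every isotropy group of $X$ belongs to $\mathcal F$ and, for every $H\in\mathcal F$, the fixed point set $X^H$ is contractible. Proposition. Let $\mathcal F$ be a family of subgroups of $G$ and let $X$ be a model for $E_{\mathcal F}G$. Suppose that (a) $\mathcal F$ is generated by a finite collection of maximal elements of the poset $(\mathcal F,\subseteq)$, and (b) the poset $(\mathcal F,\subseteq)$ satisfies the ascending chain condition. Then there are a $G$-CW-complex $Y$ and a map $f\colon X\to Y$ such that: (1) $f$ is a $G$-equivariant quotient map; (2) the $0$-skeleton $Y^{(0)}$ is $G$-finite, i.e. consists of finitely many $G$-orbits; (3) the isotropy group of every $0$-cell of $Y$ is a maximal element of $\mathcal F$, and the isotropy group of every point (equivalently, of every cell) of $Y$ belongs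 to $\mathcal F$; (4) for each $0$-cell $y$ of $Y$, the preimage $f^{-1}(y)$ is contractible and is a subcomplex of the $1$-skeleton $X^{(1)}$; (5) for every $k>1$, each open $k$-cell of $X$ is mapped by $f$ homeomorphically onto an open $k$-cell of $Y$; (6) for every $H\in\mathcal F$, the restriction $f\colon X^H\to Y^H$ is a homotopy equivalence. -/

import Mathlib

open Set Topology

universe u v

/-- A family of subgroups of `G`: a collection of subgroups closed under conjugation and under
passing to subgroups. -/
structure IsSubgroupFamily {G : Type v} [Group G] (F : Set (Subgroup G)) : Prop where
  conj_mem : ∀ H ∈ F, ∀ g : G, H.map (MulAut.conj g).toMonoidHom ∈ F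
  mem_of_le : ∀ H ∈ F, ∀ K : Subgroup G, K ≤ H → K ∈ F

/-- The family generated by a collection `P` of subgroups: the smallest family containing `P`. -/
def generatedFamily {G : Type v} [Group G] (P : Set (Subgroup G)) : Set (Subgroup G) :=
  ⋂₀ {F | IsSubgroupFamily F ∧ P ⊆ F}

/-- `X` is a `G`-CW-complex (for the discrete group `G`): a Hausdorff CW-complex with an action of
`G` by homeomorphisms which permutes the open cells of each dimension, such that a group element
which maps a cell to itself fixes it pointwise. -/
structure IsGCWComplex (G : Type v) [Group G] (X : Type u) [TopologicalSpace X] [T2Space X]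
    [MulAction G X] [CWComplex (univ : Set X)] : Prop where
  continuousConstSMul : ContinuousConstSMul G X
  cellular : ∀ (g : G) (n : ℕ) (i : RelCWComplex.cell (univ : Set X) n),
    ∃ j : RelCWComplex.cell (univ : Set X) n,
      (fun x : X => g • x) '' RelCWComplex.openCell n i = RelCWComplex.openCell n j
  fixes_pointwise : ∀ (g : G) (n : ℕ) (i : RelCWComplex.cell (univ : Set X) n),
    (fun x : X => g • x) '' RelCWComplex.openCell n i = RelCWComplex.openCell n i →
      ∀ x ∈ RelCWComplex.openCell n i, g • x = x

/-- `X` is a model for the classifying space `E_F G`: a `G`-CW-complex all of whose isotropy groups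
lie in `F` and such that the fixed point set `X^H` is contractible for every `H ∈ F`. -/
structure IsModelEFG {G : Type v} [Group G] (F : Set (Subgroup G)) (X : Type u)
    [TopologicalSpace X] [T2Space X] [MulAction G X] [CWComplex (univ : Set X)] : Prop where
  isGCWComplex : IsGCWComplex G X
  stabilizer_mem : ∀ x : X, MulAction.stabilizer G x ∈ F
  contractible_fixedPoints : ∀ H ∈ F, ContractibleSpace (MulAction.fixedPoints H X)

/-- The set of `0`-cells of a CW-complex `X`, as points of `X`, i.e. its `0`-skeleton. -/
def zeroCells (X : Type u) [TopologicalSpace X] [T2Space X] [CWComplex (univ : Set X)] :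
    Set X :=
  (RelCWComplex.skeleton (univ : Set X) 0 : Set X)

/-! The complex `Y` is obtained from `X` by collapsing every tree of a `G`-invariant forest in the
`1`-skeleton to a point.

For each generator `M` of the family, the complex `X^M` is nonempty, and by maximality each of its
`0`-cells has isotropy group exactly `M`. Choose one such `0`-cell for each `M`, and let `R` be the
union of their orbits. Every `H ∈ F` is subconjugate to some `M`, so `H` fixes a point of `R`. Each
vertex `v` can be joined to `R` by a finite chain of edges, each fixed by the isotropy group of its
initial vertex (`exists_mem_edgeLevel`). To see this, let `H` be the isotropy group of `v`. The
subcomplex `X^H` is connected and meets `R`, so one can walk back from `R` to `v` inside it. A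
vertex on the way has isotropy group `H`, and then the edge just used is fixed by it, or a strictly
larger group, and then Noetherian induction applies.

Each vertex now takes the first edge of a shortest chain. Since this edge is fixed by the isotropy
group of the vertex, the choice can be made on orbit representatives and translated
(`exists_isRootedForest`). Lengths drop by one along each edge, so the result is a forest whose
roots are the points of `R`, and it contains every vertex.

Contracting the trees to their roots is an equivariant homotopy on the forest. The homotopy
extension property on the remaining cells extends it to all of `X` (`exists_extension`). The
extension need not be equivariant, but it preserves every subcomplex `X^H`, and this is enough for
the quotient map to restrict to homotopy equivalences `X^H → Y^H`
(`exists_homotopyEquiv_fixedPoints`). The `0`-cells of `Y` are the images of the roots, and cells of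
dimension at least `2` are left alone. -/

/-! ### Building continuous maps cell by cell. -/

section CellwiseExtension
open RelCWComplex Metric

variable {X : Type u} [TopologicalSpace X]

/-- A map which becomes continuous after composition with a surjection from a compact set is
continuous. -/
lemma IsCompact.continuousOn_image_of_comp [T2Space X] {E Z : Type*} [TopologicalSpace E]
    [TopologicalSpace Z] {K : Set E} (hK : IsCompact K) {χ : E → X} (hχ : ContinuousOn χ K)
    {ψ : X → Z} (hψ : ContinuousOn (ψ ∘ χ) K) : ContinuousOn ψ (χ '' K) := by
  rw [continuousOn_iff_isClosed]
  intro B hB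
  obtain ⟨u, hu, hu'⟩ := continuousOn_iff_isClosed.1 hψ B hB
  refine ⟨χ '' (u ∩ K), ((hK.inter_left hu).image_of_continuousOn
    (hχ.mono inter_subset_right)).isClosed, ?_⟩
  rw [← hu']
  ext x
  constructor
  · rintro ⟨hx, y, hy, rfl⟩
    exact ⟨⟨y, ⟨hx, hy⟩, rfl⟩, ⟨y, hy, rfl⟩⟩
  · rintro ⟨⟨y, ⟨hx, hy⟩, rfl⟩, h⟩
    exact ⟨hx, h⟩

lemma continuousOn_of_closedCells [T2Space X] (C : Set X) [CWComplex C] {Z : Type*} [TopologicalSpace Z]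
    {Φ : X → Z} (h : ∀ n (i : cell C n), ContinuousOn Φ (closedCell n i)) :
    ContinuousOn Φ C := by
  rw [continuousOn_iff_isClosed]
  intro B hB
  refine ⟨Φ ⁻¹' B ∩ C, ?_, by rw [inter_assoc, inter_self]⟩
  rw [CWComplex.closed C _ inter_subset_right]
  intro n i
  have := (h n i).preimage_isClosed_of_isClosed isClosed_closedCell hB
  rwa [inter_assoc, inter_eq_right.2 (closedCell_subset_complex n i), inter_comm]

lemma openCell_eq_of_mem {C : Set X} [CWComplex C] {n m : ℕ} {i : cell C n} {j : cell C m} {x : X}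
    (hi : x ∈ openCell n i) (hj : x ∈ openCell m j) :
    (⟨n, i⟩ : Σ n, cell C n) = ⟨m, j⟩ :=
  eq_of_not_disjoint_openCell (not_disjoint_iff.2 ⟨x, hi, hj⟩)

lemma exists_mem_openCell {C : Set X} [CWComplex C] {x : X} (hx : x ∈ C) :
    ∃ n, ∃ i : cell C n, x ∈ openCell n i := by
  rw [← CWComplex.iUnion_openCell_eq_complex (C := C)] at hx
  simpa using hx

lemma mem_skeletonLT_iff_openCell [T2Space X] {C : Set X} [CWComplex C] {n : ℕ} {x : X} :
    x ∈ skeletonLT C n ↔ ∃ m < n, ∃ i : cell C m, x ∈ openCell m i := by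
  rw [RelCWComplex.mem_skeletonLT_iff]
  simp

/-- To construct a continuous map on a CW-complex, with a prescribed pointwise property, it
suffices to be able to extend such maps from the frontier of every cell to the cell. -/
theorem exists_continuousOn_of_cells [T2Space X] (C : Set X) [CWComplex C] {Z : Type*} [TopologicalSpace Z]
    (φ₀ : X → Z) (P : X → Z → Prop)
    (ext : ∀ n (i : cell C n) (φ : X → Z), ContinuousOn φ (cellFrontier n i) →
      (∀ x ∈ cellFrontier n i, P x (φ x)) → ∃ ψ : X → Z, ContinuousOn ψ (closedCell n i) ∧
        EqOn ψ φ (cellFrontier n i) ∧ ∀ x ∈ openCell n i, P x (ψ x)) :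
    ∃ Φ : X → Z, ContinuousOn Φ C ∧ ∀ x ∈ C, P x (Φ x) := by
  classical
  choose! E hE₁ hE₂ hE₃ using ext
  let step (n : ℕ) (φ : X → Z) (x : X) : Z :=
    if h : ∃ i : cell C n, x ∈ openCell n i then E n h.choose φ x else φ x
  -- Stage `n` has handled the cells of dimension less than `n`; outside `skeletonLT C n` its values
  -- are junk, and later stages never change it there inside.
  let Φ (n : ℕ) : X → Z := Nat.rec φ₀ step n
  have hΦ (n : ℕ) : Φ (n + 1) = step n (Φ n) := rfl
  have step_cell (n : ℕ) (i : cell C n) (φ : X → Z) (x : X) (hx : x ∈ openCell n i) :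
      step n φ x = E n i φ x := by
    have h : ∃ i : cell C n, x ∈ openCell n i := ⟨i, hx⟩
    have : h.choose = i := by simpa using openCell_eq_of_mem h.choose_spec hx
    simp only [step, dif_pos h, this]
  have step_lt (n : ℕ) (φ : X → Z) (x : X) (hx : x ∈ skeletonLT C n) : step n φ x = φ x := by
    obtain ⟨m, hm, i, hi⟩ := mem_skeletonLT_iff_openCell.1 hx
    refine dif_neg ?_
    rintro ⟨j, hj⟩
    have := openCell_eq_of_mem hi hj
    simp only [Sigma.mk.injEq] at this
    omega
  have main (n : ℕ) : ContinuousOn (Φ n) (skeletonLT C n) ∧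
      ∀ x ∈ skeletonLT C n, P x (Φ n x) := by
    induction n with
    | zero =>
      have : (skeletonLT C (0 : ℕ) : Set X) = ∅ := CWComplex.skeletonLT_zero_eq_empty
      refine ⟨by rw [this]; exact continuousOn_empty _, fun x hx => ?_⟩
      have : x ∈ (skeletonLT C (0 : ℕ) : Set X) := hx
      simp_all
    | succ n ih =>
      have front (i : cell C n) : cellFrontier n i ⊆ skeletonLT C n :=
        cellFrontier_subset_skeletonLT n i
      have c (i : cell C n) : ContinuousOn (Φ n) (cellFrontier n i) := ih.1.mono (front i)
      have p (i : cell C n) : ∀ x ∈ cellFrontier n i, P x (Φ n x) := fun x hx =>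
        ih.2 x (front i hx)
      have key (m : ℕ) (hm : m < n + 1) (i : cell C m) :
          ContinuousOn (Φ (n + 1)) (closedCell m i) := by
        rcases Nat.lt_succ_iff_lt_or_eq.1 hm with hm | rfl
        · have sub : closedCell m i ⊆ skeletonLT C n :=
            (closedCell_subset_skeletonLT m i).trans (skeletonLT_mono (by exact_mod_cast hm))
          exact (ih.1.mono sub).congr fun x hx => step_lt n _ x (sub hx)
        · refine (hE₁ m i _ (c i) (p i)).congr fun x hx => ?_
          rw [← cellFrontier_union_openCell_eq_closedCell] at hx
          rcases hx with hx | hx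
          · rw [hE₂ m i _ (c i) (p i) hx]
            exact step_lt m _ x (front i hx)
          · exact step_cell m i _ x hx
      refine ⟨continuousOn_of_closedCells _ fun m i => ?_, fun x hx => ?_⟩
      · obtain ⟨k, hk, j, hj⟩ := mem_skeletonLT_iff_openCell.1
          (Subcomplex.openCell_subset_of_mem _ i.2 (map_zero_mem_openCell m i.1))
        have := openCell_eq_of_mem (map_zero_mem_openCell m i.1) hj
        simp only [Sigma.mk.injEq] at this
        exact key m (by omega) i.1
      · obtain ⟨m, hm, i, hi⟩ := mem_skeletonLT_iff_openCell.1 hx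
        rcases Nat.lt_succ_iff_lt_or_eq.1 hm with hm | rfl
        · have hx' : x ∈ skeletonLT C n := mem_skeletonLT_iff_openCell.2 ⟨m, hm, i, hi⟩
          rw [hΦ, step_lt n _ x hx']
          exact ih.2 x hx'
        · rw [hΦ, step_cell m i _ x hi]
          exact hE₃ m i _ (c i) (p i) x hi
  have stable (n k : ℕ) (x : X) (hx : x ∈ skeletonLT C n) : Φ (n + k) x = Φ n x := by
    induction k with
    | zero => rfl
    | succ k ih =>
      rw [← ih, ← add_assoc, hΦ]
      exact step_lt _ _ x (skeletonLT_mono (by exact_mod_cast Nat.le_add_right n k) hx)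
  have ex (x : X) (hx : x ∈ C) : ∃ n : ℕ, x ∈ skeletonLT C n := by
    obtain ⟨n, i, hi⟩ := exists_mem_openCell hx
    exact ⟨n + 1, mem_skeletonLT_iff_openCell.2 ⟨n, n.lt_succ_self, i, hi⟩⟩
  let Ψ (x : X) : Z := if h : ∃ n : ℕ, x ∈ skeletonLT C n then Φ (Nat.find h) x else φ₀ x
  have hΨ (n : ℕ) (x : X) (hx : x ∈ skeletonLT C n) : Ψ x = Φ n x := by
    have h : ∃ n : ℕ, x ∈ skeletonLT C n := ⟨n, hx⟩
    obtain ⟨k, hk⟩ := Nat.exists_eq_add_of_le (Nat.find_min' h hx)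
    simp only [Ψ, dif_pos h]
    conv_rhs => rw [hk]
    exact (stable _ k x (Nat.find_spec h)).symm
  refine ⟨Ψ, continuousOn_of_closedCells C fun n i => ?_, fun x hx => ?_⟩
  · have sub : closedCell n i ⊆ skeletonLT C (n + 1 : ℕ) := closedCell_subset_skeletonLT n i
    exact ((main (n + 1)).1.mono sub).congr fun x hx => hΨ _ x (sub hx)
  · obtain ⟨n, hn⟩ := ex x hx
    rw [hΨ n x hn]
    exact (main n).2 x hn

lemma disjoint_cellFrontier_openCell [T2Space X] {C : Set X} [CWComplex C] {n : ℕ} (i j : cell C n) :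
    Disjoint (cellFrontier n i) (openCell n j) := by
  rw [disjoint_left]
  intro x hx hj
  obtain ⟨m, hm, k, hk⟩ := mem_skeletonLT_iff_openCell.1 (cellFrontier_subset_skeletonLT n i hx)
  have := openCell_eq_of_mem hk hj
  simp only [Sigma.mk.injEq] at this
  omega

/-- A map on the closed ball which on the sphere factors through the attaching map of a cell
descends to the cell. -/
lemma exists_continuousOn_closedCell [T2Space X] {C : Set X} [CWComplex C] {Z : Type*} [TopologicalSpace Z]
    {n : ℕ} (i : cell C n) {ψ' : (Fin n → ℝ) → Z} (hψ' : ContinuousOn ψ' (closedBall 0 1))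
    {φ : X → Z} (hφ : ∀ x ∈ sphere (0 : Fin n → ℝ) 1, ψ' x = φ (map n i x)) :
    ∃ ψ : X → Z, ContinuousOn ψ (closedCell n i) ∧ EqOn ψ φ (cellFrontier n i) ∧
      ∀ x ∈ closedBall (0 : Fin n → ℝ) 1, ψ (map n i x) = ψ' x := by
  classical
  let ψ (y : X) : Z := if y ∈ openCell n i then ψ' ((map n i).symm y) else φ y
  have h₁ : EqOn ψ φ (cellFrontier n i) := fun y hy =>
    if_neg (disjoint_left.1 (disjoint_cellFrontier_openCell i i) hy)
  have h₂ : ∀ x ∈ closedBall (0 : Fin n → ℝ) 1, ψ (map n i x) = ψ' x := by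
    intro x hx
    rw [← sphere_union_ball] at hx
    rcases hx with hx | hx
    · rw [h₁ (mem_image_of_mem _ hx), hφ x hx]
    · have hx' : map n i x ∈ openCell n i := mem_image_of_mem _ hx
      simp only [ψ]
      rw [if_pos hx', (map n i).left_inv]
      rwa [source_eq]
  refine ⟨ψ, ?_, h₁, h₂⟩
  exact (isCompact_closedBall _ _).continuousOn_image_of_comp (continuousOn n i)
    (hψ'.congr h₂)

end CellwiseExtension

/-! ### Homotopy extension, normality and connectedness of CW-complexes. -/

section CellwiseApplications
open RelCWComplex Metric unitInterval

variable {X : Type u} [TopologicalSpace X]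

/-- The homotopy extension property of the closed ball relative to the sphere, for homotopies
given as maps to the path space. -/
lemma exists_path_extension_closedBall {E : Type*} [NormedAddCommGroup E] [NormedSpace ℝ E]
    {χ : E → X} (hχ : ContinuousOn χ (closedBall 0 1)) {φ : E → C(I, X)}
    (hφ : ContinuousOn φ (sphere 0 1)) (h0 : ∀ x ∈ sphere (0 : E) 1, φ x 0 = χ x) :
    ∃ ψ : E → C(I, X), ContinuousOn ψ (closedBall 0 1) ∧ EqOn ψ φ (sphere 0 1) ∧
      (∀ x ∈ closedBall (0 : E) 1, ψ x 0 = χ x) ∧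
      ∀ x ∈ closedBall (0 : E) 1, ∀ t, ψ x t ∈ χ '' closedBall 0 1 ∨
        ∃ y ∈ sphere (0 : E) 1, ∃ s, ψ x t = φ y s := by
  classical
  -- The two formulas come from projecting the cylinder radially from the point `(0, 2)`: the ray
  -- through `(x, t)` leaves either through the bottom, at `(1 - t/2)⁻¹ • x`, or through the side,
  -- at height `2 - (2 - t)/‖x‖`.
  let a (p : E × I) : X := χ ((1 - (p.2 : ℝ) / 2)⁻¹ • p.1)
  let b (p : E × I) : X := φ (‖p.1‖⁻¹ • p.1) (projIcc 0 1 zero_le_one (2 - (2 - p.2) / ‖p.1‖))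
  let A : Set (E × I) := {p | ‖p.1‖ ≤ 1 - (p.2 : ℝ) / 2}
  let B : Set (E × I) := {p | 1 - (p.2 : ℝ) / 2 ≤ ‖p.1‖}
  let F (p : E × I) : X := if p ∈ A then a p else b p
  have pos (t : I) : 0 < 1 - (t : ℝ) / 2 := by have := t.2.2; linarith
  have mapsA (p : E × I) (hp : p ∈ A) : (1 - (p.2 : ℝ) / 2)⁻¹ • p.1 ∈ closedBall (0 : E) 1 := by
    rw [mem_closedBall_zero_iff, norm_smul, norm_inv, Real.norm_of_nonneg (pos _).le,
      inv_mul_le_iff₀ (pos _), mul_one]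
    exact hp
  have mapsB (p : E × I) (hp : p ∈ B) : ‖p.1‖⁻¹ • p.1 ∈ sphere (0 : E) 1 := by
    have : 0 < ‖p.1‖ := (pos _).trans_le hp
    rw [mem_sphere_zero_iff_norm, norm_smul, norm_inv, norm_norm, inv_mul_cancel₀ this.ne']
  have agree (p : E × I) (h : ‖p.1‖ = 1 - (p.2 : ℝ) / 2) : a p = b p := by
    have hp : p ∈ B := h.ge
    have e : 2 - (2 - (p.2 : ℝ)) / ‖p.1‖ = 0 := by
      have := (pos p.2).ne'
      rw [h, sub_eq_zero, eq_div_iff this]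
      ring
    simp only [b, e, projIcc_left]
    rw [show (⟨0, _⟩ : I) = 0 from rfl, h0 _ (mapsB p hp), h]
  have cA : ContinuousOn a A := by
    refine hχ.comp (Continuous.continuousOn ?_) mapsA
    have c : Continuous fun p : E × I => (1 - (p.2 : ℝ) / 2)⁻¹ :=
      Continuous.inv₀ (by fun_prop) fun p => (pos p.2).ne'
    exact c.smul continuous_fst
  have cB : ContinuousOn b B := by
    have nz (p : E × I) (hp : p ∈ B) : ‖p.1‖ ≠ 0 := ((pos _).trans_le hp).ne'
    have c₁ : ContinuousOn (fun p : E × I => φ (‖p.1‖⁻¹ • p.1)) B :=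
      hφ.comp (ContinuousOn.smul (ContinuousOn.inv₀ (by fun_prop) nz) (by fun_prop)) mapsB
    have c₂ : ContinuousOn (fun p : E × I =>
        projIcc (0 : ℝ) 1 zero_le_one (2 - (2 - p.2) / ‖p.1‖)) B :=
      continuous_projIcc.comp_continuousOn
        (continuousOn_const.sub (ContinuousOn.div (by fun_prop) (by fun_prop) nz))
    exact (ContinuousEval.continuous_eval (F := C(I, X))).comp_continuousOn (c₁.prodMk c₂)
  have closedA : IsClosed A := isClosed_le (by fun_prop) (by fun_prop)
  have closedB : IsClosed B := isClosed_le (by fun_prop) (by fun_prop)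
  have FA : EqOn F a A := fun p hp => if_pos hp
  have FB : EqOn F b B := by
    intro p hp
    by_cases h : p ∈ A
    · exact (if_pos h).trans (agree p (le_antisymm h hp))
    · exact if_neg h
  have cF : Continuous F := by
    rw [← continuousOn_univ, ← show A ∪ B = univ from
      eq_univ_of_forall fun p => le_total ‖p.1‖ (1 - (p.2 : ℝ) / 2)]
    exact (cA.congr FA).union_of_isClosed (cB.congr FB) closedA closedB
  let Fc : C(E, C(I, X)) := ContinuousMap.curry ⟨F, cF⟩
  refine ⟨Fc, Fc.continuous.continuousOn, fun x hx => ?_, fun x hx => ?_, fun x hx t => ?_⟩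
  · ext t
    have hx' : ‖x‖ = 1 := by simpa using hx
    have hB : (x, t) ∈ B := by
      have := t.2.1
      change 1 - (t : ℝ) / 2 ≤ ‖x‖
      linarith
    change F (x, t) = _
    rw [FB hB]
    simp [b, hx']
  · have hA : (x, (0 : I)) ∈ A := by simpa [A] using hx
    change F (x, 0) = _
    rw [FA hA]
    simp [a]
  · change F (x, t) ∈ _ ∨ ∃ y ∈ _, ∃ s, F (x, t) = _
    rcases le_total ‖x‖ (1 - (t : ℝ) / 2) with h | h
    · exact Or.inl (by rw [FA h]; exact ⟨_, mapsA _ h, rfl⟩)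
    · exact Or.inr (by rw [FB h]; exact ⟨_, mapsB _ h, _, rfl⟩)

/-- The homotopy extension property of a cell relative to its frontier. -/
lemma exists_path_extension_closedCell [T2Space X] {C : Set X} [CWComplex C] {n : ℕ}
    (i : cell C n) {φ : X → C(I, X)} (hφ : ContinuousOn φ (cellFrontier n i))
    (h0 : ∀ x ∈ cellFrontier n i, φ x 0 = x) :
    ∃ ψ : X → C(I, X), ContinuousOn ψ (closedCell n i) ∧ EqOn ψ φ (cellFrontier n i) ∧
      ∀ x ∈ closedCell n i, ψ x 0 = x ∧ ∀ t, ψ x t ∈ closedCell n i ∨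
        ∃ y ∈ cellFrontier n i, ∃ s, ψ x t = φ y s := by
  obtain ⟨ψ', c, e, z, m⟩ := exists_path_extension_closedBall (continuousOn n i)
    (φ := φ ∘ map n i)
    (hφ.comp ((continuousOn n i).mono sphere_subset_closedBall) (mapsTo_image _ _))
    fun x hx => h0 _ (mem_image_of_mem _ hx)
  obtain ⟨ψ, c', e', hψ⟩ := exists_continuousOn_closedCell i c e
  refine ⟨ψ, c', e', ?_⟩
  rintro _ ⟨x, hx, rfl⟩
  rw [hψ x hx]
  refine ⟨z x hx, fun t => ?_⟩
  rcases m x hx t with h | ⟨y, hy, s, h⟩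
  · exact Or.inl h
  · exact Or.inr ⟨_, mem_image_of_mem _ hy, s, h⟩

/-- Urysohn's lemma proved cell by cell: on a compact Hausdorff closed cell, Tietze extends the
values prescribed on the frontier and on `A` and `B`. The resulting normality of `X` is what makes
the collapse Hausdorff. -/
lemma CWComplex.exists_continuous_zero_one [T2Space X] [CWComplex (univ : Set X)] {A B : Set X}
    (hA : IsClosed A) (hB : IsClosed B) (hAB : Disjoint A B) :
    ∃ Φ : X → ℝ, Continuous Φ ∧ EqOn Φ 0 A ∧ EqOn Φ 1 B := by
  classical
  have := exists_continuousOn_of_cells (univ : Set X) (fun _ => (0 : ℝ))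
    (fun x z => (x ∈ A → z = 0) ∧ (x ∈ B → z = 1)) ?_
  · obtain ⟨Φ, hΦ, h⟩ := this
    exact ⟨Φ, continuousOn_univ.1 hΦ, fun x hx => (h x trivial).1 hx,
      fun x hx => (h x trivial).2 hx⟩
  intro n i φ hφ hP
  let K := closedCell n i
  let φ' (x : X) : ℝ := if x ∈ A then 0 else if x ∈ B then 1 else φ x
  have eA : EqOn φ' (fun _ => 0) A := fun x hx => if_pos hx
  have eB : EqOn φ' (fun _ => 1) B := fun x hx =>
    (if_neg (disjoint_right.1 hAB hx)).trans (if_pos hx)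
  have eF : EqOn φ' φ (cellFrontier n i) := by
    intro x hx
    by_cases h : x ∈ A
    · rw [eA h, (hP x hx).1 h]
    by_cases h' : x ∈ B
    · rw [eB h', (hP x hx).2 h']
    simp [φ', h, h']
  let S := cellFrontier n i ∪ (A ∪ B)
  have hS : IsClosed S := isClosed_cellFrontier.union (hA.union hB)
  have cS : ContinuousOn φ' S := (hφ.congr eF).union_of_isClosed
    ((continuousOn_const.congr eA).union_of_isClosed (continuousOn_const.congr eB) hA hB)
    isClosed_cellFrontier (hA.union hB)
  have : CompactSpace K := isCompact_iff_compactSpace.1 isCompact_closedCell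
  let S' : Set K := Subtype.val ⁻¹' S
  have hS' : IsClosed S' := hS.preimage continuous_subtype_val
  let f : C(S', ℝ) := ⟨fun x => φ' x.1.1,
    cS.comp_continuous (continuous_subtype_val.comp continuous_subtype_val) fun x => x.2⟩
  obtain ⟨g, hg⟩ := f.exists_restrict_eq hS'
  let ψ (x : X) : ℝ := if h : x ∈ K then g ⟨x, h⟩ else 0
  have hψ (x : X) (hx : x ∈ K) (hx' : x ∈ S) : ψ x = φ' x := by
    simp only [ψ, dif_pos hx]
    exact DFunLike.congr_fun hg ⟨⟨x, hx⟩, hx'⟩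
  refine ⟨ψ, ?_, fun x hx => ?_, fun x hx => ⟨fun h => ?_, fun h => ?_⟩⟩
  · rw [continuousOn_iff_continuous_domRestrict]
    convert g.continuous using 1
    ext x
    simp [ψ, K]
  · rw [hψ x (cellFrontier_subset_closedCell n i hx) (Or.inl hx), eF hx]
  · rw [hψ x (openCell_subset_closedCell n i hx) (Or.inr (Or.inl h)), eA h]
  · rw [hψ x (openCell_subset_closedCell n i hx) (Or.inr (Or.inr h)), eB h]

lemma CWComplex.normalSpace [T2Space X] [CWComplex (univ : Set X)] : NormalSpace X where
  normal A B hA hB hAB := by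
    obtain ⟨Φ, hΦ, h0, h1⟩ := CWComplex.exists_continuous_zero_one hA hB hAB
    refine ⟨Φ ⁻¹' Iio (1 / 2), Φ ⁻¹' Ioi (1 / 2), isOpen_Iio.preimage hΦ,
      isOpen_Ioi.preimage hΦ, fun x hx => ?_, fun x hx => ?_, ?_⟩
    · simp [h0 hx]
    · simp only [mem_preimage, h1 hx, mem_Ioi, Pi.one_apply]
      norm_num
    · exact Disjoint.preimage _ (disjoint_left.2 fun x (hx : x < 1 / 2) hx' => lt_asymm hx hx')

/-- In a connected CW-complex, a nonempty set of `0`-cells which is closed under adjacency contains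
all `0`-cells. -/
lemma CWComplex.mem_of_isPreconnected [T2Space X] (C : Set X) [CWComplex C]
    (hC : IsPreconnected C) (W : Set X)
    (hW : ∀ (e : cell C 1), ∀ x ∈ cellFrontier 1 e, ∀ y ∈ cellFrontier 1 e, x ∈ W → y ∈ W)
    {i j : cell C 0} {x y : X} (hx : x ∈ openCell 0 i) (hy : y ∈ openCell 0 j) (hxW : x ∈ W) :
    y ∈ W := by
  classical
  -- The indicator of `W` on the `0`-cells extends to a continuous `Bool`-valued map: over a
  -- `1`-cell because both ends agree on membership in `W`, over higher cells because their
  -- attaching spheres are connected. Such a map is constant on `C`.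
  obtain ⟨Φ, hΦ, h⟩ := exists_continuousOn_of_cells C (fun _ => true)
    (fun x z => ∀ i : cell C 0, x ∈ openCell 0 i → z = decide (x ∈ W)) (by
      intro n i φ hφ hP
      rcases n with _ | n
      · refine ⟨fun _ => decide (map 0 i ![] ∈ W), continuousOn_const, ?_, ?_⟩
        · rw [cellFrontier_zero_eq_empty]
          exact eqOn_empty _ _
        · intro x hx j hj
          rw [openCell_zero_eq_singleton] at hx
          rw [show x = map 0 i ![] from hx]
      · obtain ⟨z, hz⟩ := CWComplex.nonempty_cellFrontier n.succ_ne_zero i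
        have const : ∀ x ∈ cellFrontier (n + 1) i, φ x = φ z := by
          intro x hx
          rcases n with _ | n
          · have key : ∀ x ∈ cellFrontier (0 + 1) i, φ x = decide (x ∈ W) := by
              intro x hx
              obtain ⟨m, hm, j, hj⟩ :=
                mem_skeletonLT_iff_openCell.1 (cellFrontier_subset_skeletonLT _ i hx)
              obtain rfl : m = 0 := by omega
              exact hP x hx j hj
            rw [key x hx, key z hz]
            congr 1
            exact propext ⟨hW i x hx z hz, hW i z hz x hx⟩
          · have : IsPreconnected (cellFrontier (n + 1 + 1) i) := by
              refine IsPreconnected.image ?_ _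
                ((RelCWComplex.continuousOn _ i).mono sphere_subset_closedBall)
              refine isPreconnected_sphere ?_ _ _
              rw [rank_fin_fun]
              exact_mod_cast Nat.one_lt_succ_succ n
            exact this.constant hφ hx hz
        refine ⟨fun _ => φ z, continuousOn_const, fun x hx => (const x hx).symm, ?_⟩
        intro x hx j hj
        have := openCell_eq_of_mem hx hj
        simp at this)
  have e := hC.constant hΦ (openCell_subset_complex 0 i hx) (openCell_subset_complex 0 j hy)
  rw [h x (openCell_subset_complex 0 i hx) i hx, h y (openCell_subset_complex 0 j hy) j hy] at e
  simpa [hxW] using e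

end CellwiseApplications

/-! ### Collapsing subcomplexes to points: topology and cell structure of the quotient. -/

section Collapse
open RelCWComplex Metric

variable {X : Type u} [TopologicalSpace X] [T2Space X] [CWComplex (univ : Set X)]

lemma mem_zeroCells {x : X} :
    x ∈ zeroCells X ↔ ∃ i : cell (univ : Set X) 0, x ∈ openCell 0 i := by
  have : zeroCells X = (skeletonLT (univ : Set X) (1 : ℕ) : Set X) := by
    simp [zeroCells, skeleton]
  rw [this, SetLike.mem_coe, mem_skeletonLT_iff_openCell]
  simp

lemma eq_zero_of_mem_zeroCells {x : X} {n : ℕ} {i : cell (univ : Set X) n}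
    (hx : x ∈ openCell n i) (h : x ∈ zeroCells X) : n = 0 := by
  obtain ⟨j, hj⟩ := mem_zeroCells.1 h
  have := openCell_eq_of_mem hx hj
  simp only [Sigma.mk.injEq] at this
  exact this.1

omit [T2Space X] in
lemma closedCell_eq_openCell_zero (i : cell (univ : Set X) 0) :
    closedCell 0 i = openCell 0 i := by
  rw [closedCell_zero_eq_singleton, openCell_zero_eq_singleton]

/-- The map `q` collapses some of the closed cells of `X` to `0`-cells fixed by `q`, and is the
identity on all other open cells. -/
def IsCellCollapse (q : X → X) : Prop :=
  ∀ n (i : cell (univ : Set X) n), (∀ x ∈ openCell n i, q x = x) ∨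
    ∃ r ∈ zeroCells X, q r = r ∧ ∀ x ∈ closedCell n i, q x = r

/-- The quotient of `X` obtained by identifying points with the same image under `q`. -/
abbrev CollapseQuotient (q : X → X) : Type u := Quotient (Setoid.ker q)

/-- The quotient map to the collapse. -/
def CollapseQuotient.mk (q : X → X) (x : X) : CollapseQuotient q := Quotient.mk _ x

/-- The canonical representatives of the points of the collapse. -/
def CollapseQuotient.rep (q : X → X) : CollapseQuotient q → X := Quotient.lift q fun _ _ h => h

namespace IsCellCollapse
open CollapseQuotient

omit [TopologicalSpace X] [T2Space X] [CWComplex (univ : Set X)] in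
lemma mk_eq_mk {q : X → X} {x y : X} : mk q x = mk q y ↔ q x = q y := Quotient.eq

omit [TopologicalSpace X] [T2Space X] [CWComplex (univ : Set X)] in
lemma mk_surjective {q : X → X} : Function.Surjective (mk q) := Quotient.mk_surjective

omit [T2Space X] [CWComplex (univ : Set X)] in
lemma isQuotientMap_mk {q : X → X} : IsQuotientMap (mk q) := isQuotientMap_quotient_mk'

variable {q : X → X} (hq : IsCellCollapse q)
include hq

lemma eq_or_mem (x : X) : q x = x ∨ q x ∈ zeroCells X ∧ q (q x) = q x := by
  obtain ⟨n, i, hi⟩ := exists_mem_openCell (mem_univ x)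
  rcases hq n i with h | ⟨r, hr, hr', h⟩
  · exact Or.inl (h x hi)
  · have := h x (openCell_subset_closedCell n i hi)
    exact Or.inr ⟨by rwa [this], by rw [this, hr']⟩

lemma idem (x : X) : q (q x) = q x := by
  rcases hq.eq_or_mem x with h | h
  · rw [h]
    exact h
  · exact h.2

lemma mk_apply (x : X) : mk q (q x) = mk q x := mk_eq_mk.2 (hq.idem x)

/-- The preimage of a set of fixed `0`-cells under a cellular collapse is a subcomplex. -/
lemma exists_subcomplex (D : Set X) (hD : ∀ r ∈ D, r ∈ zeroCells X ∧ q r = r) :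
    ∃ T : Subcomplex (univ : Set X), (T : Set X) = q ⁻¹' D := by
  -- A cell that meets the preimage lies in it with its closure: it is either collapsed as a whole
  -- or itself a `0`-cell.
  have key (n) (i : cell (univ : Set X) n) (x : X) (hx : x ∈ openCell n i) (h : q x ∈ D) :
      closedCell n i ⊆ q ⁻¹' D := by
    rcases hq n i with hi | ⟨r, hr, hr', hi⟩
    · rw [hi x hx] at h
      obtain rfl := eq_zero_of_mem_zeroCells hx (hD x h).1
      rw [closedCell_eq_openCell_zero]
      rw [openCell_zero_eq_singleton] at hx ⊢
      rintro _ rfl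
      rw [mem_preimage, ← show x = _ from hx, (hD x h).2]
      exact h
    · intro y hy
      rw [hi x (openCell_subset_closedCell n i hx)] at h
      rwa [mem_preimage, hi y hy]
  refine ⟨CWComplex.Subcomplex.mk' _ (q ⁻¹' D) (fun n => {i | closedCell n i ⊆ q ⁻¹' D})
    (fun n i => i.2) ?_, rfl⟩
  ext x
  simp only [mem_iUnion]
  constructor
  · rintro ⟨n, i, hx⟩
    exact i.2 (openCell_subset_closedCell n _ hx)
  · intro h
    obtain ⟨n, i, hi⟩ := exists_mem_openCell (mem_univ x)
    exact ⟨n, ⟨i, key n i x hi h⟩, hi⟩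

lemma isClosed_preimage (D : Set X) (hD : ∀ r ∈ D, r ∈ zeroCells X ∧ q r = r) :
    IsClosed (q ⁻¹' D) := by
  obtain ⟨T, hT⟩ := hq.exists_subcomplex D hD
  rw [← hT]
  exact T.closed

/-- The saturation of a closed set `A` is `A` together with the preimage of the collapse points that
`A` reaches, and that preimage is a subcomplex, hence closed. -/
lemma isClosedMap_mk : IsClosedMap (mk q) := by
  intro A hA
  rw [← isQuotientMap_mk.isClosed_preimage]
  let D : Set X := q '' A ∩ {r | r ∈ zeroCells X ∧ q r = r}
  have : mk q ⁻¹' (mk q '' A) = A ∪ q ⁻¹' D := by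
    ext x
    constructor
    · rintro ⟨a, ha, hax⟩
      have hax := mk_eq_mk.1 hax
      rcases hq.eq_or_mem x with h | h
      · rcases hq.eq_or_mem a with h' | h'
        · left
          rwa [← h, ← hax, h']
        · right
          exact ⟨⟨a, ha, hax⟩, by rw [hax] at h'; exact h'⟩
      · exact Or.inr ⟨⟨a, ha, hax⟩, h⟩
    · rintro (h | ⟨⟨a, ha, hax⟩, -⟩)
      · exact ⟨x, h, rfl⟩
      · exact ⟨a, ha, mk_eq_mk.2 hax⟩
  rw [this]
  exact hA.union (hq.isClosed_preimage D inter_subset_right)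

lemma isClosed_fiber (y : CollapseQuotient q) : IsClosed (mk q ⁻¹' {y}) := by
  obtain ⟨x, rfl⟩ := mk_surjective y
  have := (hq.isClosedMap_mk _ (isClosed_singleton (x := x))).preimage
    (isQuotientMap_mk (q := q)).continuous
  rwa [image_singleton] at this

/-- Two fibres are disjoint closed sets in a normal space. Since the quotient map is closed, open
sets separating them contain saturated open sets around the fibres. -/
lemma t2Space : T2Space (CollapseQuotient q) where
  t2 y z hyz := by
    have := CWComplex.normalSpace (X := X)
    obtain ⟨U, V, hU, hV, hyU, hzV, hUV⟩ := normal_separation (hq.isClosed_fiber y)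
      (hq.isClosed_fiber z) (Disjoint.preimage _ (disjoint_singleton.2 hyz))
    have key {W : Set X} (hW : IsOpen W) {y : CollapseQuotient q} (hy : mk q ⁻¹' {y} ⊆ W) :
        IsOpen (mk q '' Wᶜ)ᶜ ∧ y ∈ (mk q '' Wᶜ)ᶜ := by
      refine ⟨(hq.isClosedMap_mk _ hW.isClosed_compl).isOpen_compl, ?_⟩
      rintro ⟨x, hx, hxy⟩
      exact hx (hy hxy)
    refine ⟨_, _, (key hU hyU).1, (key hV hzV).1, (key hU hyU).2, (key hV hzV).2, ?_⟩
    rw [disjoint_left]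
    intro w hw hw'
    obtain ⟨x, rfl⟩ := mk_surjective w
    have hxU : x ∈ U := by_contra fun h => hw ⟨x, h, rfl⟩
    have hxV : x ∈ V := by_contra fun h => hw' ⟨x, h, rfl⟩
    exact disjoint_left.1 hUV hxU hxV

omit hq [TopologicalSpace X] [T2Space X] [CWComplex (univ : Set X)] in
lemma injOn_mk {s : Set X} (hs : ∀ x ∈ s, q x = x) : InjOn (mk q) s := by
  intro x hx y hy h
  rw [← hs x hx, ← hs y hy]
  exact mk_eq_mk.1 h

omit hq [T2Space X] in
lemma eq_of_mk_eq {n : ℕ} {i : cell (univ : Set X) n} (hi : ∀ x ∈ openCell n i, q x = x)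
    {m : ℕ} {j : cell (univ : Set X) m} (hj : ∀ x ∈ openCell m j, q x = x) {x y : X}
    (hx : x ∈ openCell n i) (hy : y ∈ openCell m j) (h : mk q x = mk q y) : x = y := by
  rw [← hi x hx, ← hj y hy]
  exact mk_eq_mk.1 h

lemma isEmbedding_restrict {n : ℕ} {i : cell (univ : Set X) n}
    (hi : ∀ x ∈ openCell n i, q x = x) :
    IsEmbedding ((openCell n i).domRestrict (mk q)) := by
  rcases Nat.eq_zero_or_pos n with rfl | hn
  · have : Subsingleton (openCell 0 i) := by
      rw [openCell_zero_eq_singleton]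
      infer_instance
    exact IsEmbedding.of_subsingleton _
  -- An uncollapsed cell of positive dimension is saturated. This can fail for a `0`-cell, whose
  -- fibre may be a whole tree, so that case was settled separately.
  have sat : mk q ⁻¹' (mk q '' openCell n i) = openCell n i := by
    refine subset_antisymm ?_ (subset_preimage_image _ _)
    rintro x ⟨y, hy, hyx⟩
    have hyx := mk_eq_mk.1 hyx
    rw [hi y hy] at hyx
    rcases hq.eq_or_mem x with h | h
    · rwa [← h, ← hyx]
    · rw [← hyx] at h
      exact absurd (eq_zero_of_mem_zeroCells hy h.1) hn.ne'
  have c : Continuous ((openCell n i).domRestrict (mk q)) :=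
    isQuotientMap_mk.continuous.comp continuous_subtype_val
  have inj : Function.Injective ((openCell n i).domRestrict (mk q)) :=
    (injOn_mk hi).injective
  refine ⟨⟨le_antisymm c.le_induced ?_⟩, inj⟩
  rw [TopologicalSpace.le_def]
  intro U hU
  obtain ⟨V, hV, rfl⟩ := isOpen_induced_iff.1 hU
  refine isOpen_induced_iff.2
    ⟨(mk q '' Vᶜ)ᶜ, (hq.isClosedMap_mk _ hV.isClosed_compl).isOpen_compl, ?_⟩
  ext ⟨x, hx⟩
  constructor
  · intro h
    by_contra hxV
    exact h ⟨x, hxV, rfl⟩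
  · rintro h ⟨b, hb, hbx⟩
    have hb' : b ∈ openCell n i := by
      rw [← sat]
      exact ⟨x, hx, hbx.symm⟩
    exact hb ((injOn_mk hi hb' hx hbx) ▸ h)

/-- On the image of a single uncollapsed open cell, `rep q` inverts an embedding. This continuity is
what the inverse characteristic maps of the quotient need. -/
lemma continuousOn_rep {n : ℕ} {i : cell (univ : Set X) n}
    (hi : ∀ x ∈ openCell n i, q x = x) :
    ContinuousOn (rep q) (mk q '' openCell n i) := by
  have emb := hq.isEmbedding_restrict hi
  rintro _ ⟨x, hx, rfl⟩
  have hr : mk q '' openCell n i = range ((openCell n i).domRestrict (mk q)) := by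
    rw [range_domRestrict]
  rw [hr]
  have : Filter.Tendsto (rep q)
      (Filter.map ((openCell n i).domRestrict (mk q)) (𝓝 ⟨x, hx⟩)) (𝓝 (q x)) := by
    rw [Filter.tendsto_map'_iff]
    have e : rep q ∘ (openCell n i).domRestrict (mk q) = Subtype.val :=
      funext fun y => hi y y.2
    rw [e, hi x hx]
    exact continuous_subtype_val.tendsto _
  rw [emb.isInducing.map_nhds_eq] at this
  exact this

lemma exists_cell (n : ℕ) (i : cell (univ : Set X) n) :
    ∃ m ≤ n, ∃ k : cell (univ : Set X) m, (∀ x ∈ openCell m k, q x = x) ∧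
      ∀ x ∈ openCell n i, q x ∈ openCell m k := by
  rcases hq n i with hi | ⟨r, hr, hr', hi⟩
  · exact ⟨n, le_rfl, i, hi, fun x hx => by rwa [hi x hx]⟩
  · obtain ⟨k, hk⟩ := mem_zeroCells.1 hr
    refine ⟨0, n.zero_le, k, fun x hx => ?_, fun x hx => ?_⟩
    · rw [openCell_zero_eq_singleton] at hk hx
      rwa [show x = r from Eq.trans hx (Eq.symm hk)]
    · rwa [hi x (openCell_subset_closedCell n i hx)]

/-- The cell structure on the collapse: its cells are the images of the cells on which `q` is the
identity. -/
@[reducible]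
def cwComplex : CWComplex (univ : Set (CollapseQuotient q)) where
  cell n := {i : cell (univ : Set X) n // ∀ x ∈ openCell n i, q x = x}
  map n i :=
    { toFun := fun x => mk q (map n i.1 x)
      invFun := fun y => (map n i.1).symm (rep q y)
      source := ball 0 1
      target := mk q '' openCell n i.1
      map_source' := fun x hx => mem_image_of_mem _ (mem_image_of_mem _ hx)
      map_target' := by
        rintro _ ⟨x, hx, rfl⟩
        have : rep q (mk q x) = x := i.2 x hx
        obtain ⟨z, hz, rfl⟩ := hx
        rw [← source_eq n i.1] at hz ⊢
        rw [this]
        exact (map n i.1).map_target ((map n i.1).map_source hz)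
      left_inv' := by
        intro z hz
        have : rep q (mk q (map n i.1 z)) = map n i.1 z := i.2 _ (mem_image_of_mem _ hz)
        rw [← source_eq n i.1] at hz
        rw [this, (map n i.1).left_inv hz]
      right_inv' := by
        rintro _ ⟨x, hx, rfl⟩
        have : rep q (mk q x) = x := i.2 x hx
        obtain ⟨z, hz, rfl⟩ := hx
        rw [← source_eq n i.1] at hz
        rw [this, (map n i.1).left_inv hz] }
  source_eq n i := rfl
  continuousOn n i :=
    (isQuotientMap_mk (q := q)).continuous.comp_continuousOn (continuousOn n i.1)
  continuousOn_symm n i := by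
    refine (continuousOn_symm n i.1).comp (hq.continuousOn_rep i.2) ?_
    rintro _ ⟨x, hx, rfl⟩
    have : rep q (mk q x) = x := i.2 x hx
    rw [this]
    obtain ⟨z, hz, rfl⟩ := hx
    rw [← source_eq n i.1] at hz
    exact (map n i.1).map_source hz
  pairwiseDisjoint' := by
    rintro ⟨n, i⟩ - ⟨m, j⟩ - hne
    simp only [Function.onFun]
    rw [disjoint_left]
    rintro _ ⟨x, hx, rfl⟩ ⟨y, hy, hxy⟩
    have hx' : map n i.1 x ∈ openCell n i.1 := mem_image_of_mem _ hx
    have hy' : map m j.1 y ∈ openCell m j.1 := mem_image_of_mem _ hy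
    have := eq_of_mk_eq i.2 j.2 hx' hy' hxy.symm
    rw [← this] at hy'
    have h := openCell_eq_of_mem hx' hy'
    simp only [Sigma.mk.injEq] at h
    obtain ⟨rfl, h⟩ := h
    exact hne (by rw [Subtype.ext (eq_of_heq h)])
  mapsTo' n i := by
    classical
    obtain ⟨J, hJ⟩ := CWComplex.cellFrontier_subset_finite_openCell n i.1
    -- The frontier meets finitely many open cells, and each of them is mapped into one cell of the
    -- quotient of no larger dimension; these cells form the required finite set.
    choose d hd k hk hkm using hq.exists_cell
    let s : Finset (Σ m, {i : cell (univ : Set X) m // ∀ x ∈ openCell m i, q x = x}) :=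
      ((Finset.range n).sigma J).image fun j => ⟨d j.1 j.2, k j.1 j.2, hk j.1 j.2⟩
    have inj (m : ℕ) : Function.Injective (Sigma.mk
        (β := fun m => {i : cell (univ : Set X) m // ∀ x ∈ openCell m i, q x = x}) m) :=
      sigma_mk_injective
    refine ⟨fun m => s.preimage _ (inj m).injOn, fun x hx => ?_⟩
    have := hJ (mem_image_of_mem _ hx)
    simp only [mem_iUnion] at this
    obtain ⟨m, hm, j, hj, hxj⟩ := this
    simp only [mem_iUnion]
    refine ⟨d m j, (hd m j).trans_lt hm, ⟨k m j, hk m j⟩, ?_, ?_⟩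
    · rw [Finset.mem_preimage, Finset.mem_image]
      exact ⟨⟨m, j⟩, by simpa using ⟨hm, hj⟩, rfl⟩
    · obtain ⟨z, hz, hzx⟩ := hkm m j _ hxj
      exact ⟨z, ball_subset_closedBall hz, (congrArg (mk q) hzx).trans (hq.mk_apply _)⟩
  closed' A _ hA := by
    rw [← isQuotientMap_mk.isClosed_preimage, CWComplex.closed univ _ (subset_univ _)]
    intro n i
    rcases hq n i with hi | ⟨r, hr, hr', hi⟩
    · have := (hA n ⟨i, hi⟩).preimage (isQuotientMap_mk (q := q)).continuous
      convert this.inter (isClosed_closedCell (n := n) (i := i)) using 1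
      ext x
      constructor
      · rintro ⟨h, z, hz, rfl⟩
        exact ⟨⟨h, z, hz, rfl⟩, z, hz, rfl⟩
      · rintro ⟨⟨h, -⟩, h'⟩
        exact ⟨h, h'⟩
    -- A collapsed closed cell goes to one point, so the preimage of `A` contains all of it or none
    -- of it.
    · by_cases h : mk q r ∈ A
      · convert (isClosed_closedCell (n := n) (i := i)) using 1
        refine inter_eq_right.2 fun x hx => ?_
        rw [mem_preimage, mk_eq_mk.2 ((hi x hx).trans hr'.symm)]
        exact h
      · convert isClosed_empty using 1
        refine eq_empty_of_forall_notMem ?_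
        rintro x ⟨hx, hx'⟩
        rw [mem_preimage, mk_eq_mk.2 ((hi x hx').trans hr'.symm)] at hx
        exact h hx
  union' := by
    refine eq_univ_of_forall fun y => ?_
    obtain ⟨x, rfl⟩ := mk_surjective y
    obtain ⟨n, i, hx⟩ := exists_mem_openCell (mem_univ x)
    obtain ⟨m, -, k, hk, hk'⟩ := hq.exists_cell n i
    obtain ⟨z, hz, hzx⟩ := hk' x hx
    simp only [mem_iUnion]
    exact ⟨m, ⟨k, hk⟩, z, ball_subset_closedBall hz, (congrArg (mk q) hzx).trans (hq.mk_apply _)⟩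

lemma mem_zeroCells_mk [T2Space (CollapseQuotient q)] {y : CollapseQuotient q} :
    letI := hq.cwComplex
    y ∈ zeroCells (CollapseQuotient q) ↔ ∃ r ∈ zeroCells X, q r = r ∧ mk q r = y := by
  let := hq.cwComplex
  rw [mem_zeroCells]
  constructor
  · rintro ⟨i, z, hz, rfl⟩
    have : map 0 i.1 z ∈ openCell 0 i.1 := mem_image_of_mem _ hz
    exact ⟨map 0 i.1 z, mem_zeroCells.2 ⟨i.1, this⟩, i.2 _ this, rfl⟩
  · rintro ⟨r, hr, hr', rfl⟩
    obtain ⟨i, hi⟩ := mem_zeroCells.1 hr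
    have h : ∀ x ∈ openCell 0 i, q x = x := by
      intro x hx
      rw [openCell_zero_eq_singleton] at hi hx
      rwa [show x = r from Eq.trans hx (Eq.symm hi)]
    obtain ⟨z, hz, rfl⟩ := hi
    exact ⟨⟨i, h⟩, z, hz, rfl⟩

lemma exists_openCell_eq_image [T2Space (CollapseQuotient q)] {n : ℕ}
    {i : cell (univ : Set X) n} (hi : ∀ x ∈ openCell n i, q x = x) :
    letI := hq.cwComplex
    ∃ j : cell (univ : Set (CollapseQuotient q)) n, openCell n j = mk q '' openCell n i := by
  let := hq.cwComplex
  exact ⟨⟨i, hi⟩, (image_image (mk q) (map n i) (ball 0 1)).symm⟩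

lemma openCell_eq_image [T2Space (CollapseQuotient q)] (n : ℕ) :
    letI := hq.cwComplex
    ∀ j : cell (univ : Set (CollapseQuotient q)) n, ∃ i : cell (univ : Set X) n,
      (∀ x ∈ openCell n i, q x = x) ∧ openCell n j = mk q '' openCell n i := by
  let := hq.cwComplex
  exact fun j => ⟨j.1, j.2, (image_image (mk q) (map n j.1) (ball 0 1)).symm⟩

end IsCellCollapse

end Collapse

/-! ### Group action and homotopy equivalences for the collapse. -/

section EquivariantCollapse
open RelCWComplex unitInterval

variable {G : Type v} [Group G] {X : Type u} [MulAction G X] {q : X → X}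

/-- The action on the collapse induced by an action for which `q` is equivariant. -/
@[reducible]
def CollapseQuotient.mulAction (heq : ∀ (g : G) x, q (g • x) = g • q x) :
    MulAction G (CollapseQuotient q) where
  smul g := Quotient.map (g • ·) fun x y (h : q x = q y) =>
    show q (g • x) = q (g • y) by rw [heq, heq, h]
  one_smul := by
    rintro ⟨x⟩
    exact congrArg (mk q) (one_smul G x)
  mul_smul a b := by
    rintro ⟨x⟩
    exact congrArg (mk q) (mul_smul a b x)

namespace IsCellCollapse
open CollapseQuotient

lemma smul_mk (heq : ∀ (g : G) x, q (g • x) = g • q x) (g : G) (x : X) :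
    letI := mulAction heq
    g • mk q x = mk q (g • x) := rfl

lemma smul_mk_eq_iff (heq : ∀ (g : G) x, q (g • x) = g • q x) (g : G) (x : X) :
    letI := mulAction heq
    g • mk q x = mk q x ↔ g • q x = q x := by
  let := mulAction heq
  rw [smul_mk, mk_eq_mk, heq]

lemma stabilizer_mk (heq : ∀ (g : G) x, q (g • x) = g • q x) (x : X) :
    letI := mulAction heq
    MulAction.stabilizer G (mk q x) = MulAction.stabilizer G (q x) := by
  let := mulAction heq
  ext g
  exact smul_mk_eq_iff heq g x

variable [TopologicalSpace X] [T2Space X] [CWComplex (univ : Set X)] (hq : IsCellCollapse q)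
include hq

lemma isGCWComplex (hX : IsGCWComplex G X) (heq : ∀ (g : G) x, q (g • x) = g • q x) :
    letI := mulAction heq
    letI := hq.t2Space
    letI := hq.cwComplex
    IsGCWComplex G (CollapseQuotient q) := by
  let := mulAction heq
  have := hq.t2Space
  let := hq.cwComplex
  have transl (g : G) (n) (i j : cell (univ : Set X) n)
      (hj : (fun x : X => g • x) '' openCell n i = openCell n j) :
      (fun x : CollapseQuotient q => g • x) '' (mk q '' openCell n i) = mk q '' openCell n j := by
    rw [← hj, image_image, image_image]
    rfl
  have transl_fix (g : G) (n) (i j : cell (univ : Set X) n) (hi : ∀ x ∈ openCell n i, q x = x)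
      (hj : (fun x : X => g • x) '' openCell n i = openCell n j) :
      ∀ x ∈ openCell n j, q x = x := by
    rw [← hj]
    rintro _ ⟨x, hx, rfl⟩
    exact (heq g x).trans (congrArg (g • ·) (hi x hx))
  refine ⟨⟨fun g => ?_⟩, fun g n j => ?_, fun g n j hj => ?_⟩
  · have := hX.continuousConstSMul
    exact isQuotientMap_mk.continuous_iff.2
      ((isQuotientMap_mk (q := q)).continuous.comp (continuous_const_smul g))
  · obtain ⟨i, hi, hij⟩ := hq.openCell_eq_image n j
    obtain ⟨k, hk⟩ := hX.cellular g n i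
    obtain ⟨l, hl⟩ := hq.exists_openCell_eq_image (transl_fix g n i k hi hk)
    exact ⟨l, by rw [hij, hl, transl g n i k hk]⟩
  · obtain ⟨i, hi, hij⟩ := hq.openCell_eq_image n j
    obtain ⟨k, hk⟩ := hX.cellular g n i
    rw [hij, transl g n i k hk] at hj
    -- The quotient map is injective across uncollapsed cells, so equality of the image cells comes
    -- from equality in `X`, where `fixes_pointwise` applies.
    obtain rfl : k = i := by
      obtain ⟨x, hx⟩ := openCell_nonempty n k
      obtain ⟨y, hy, hyx⟩ : mk q x ∈ mk q '' openCell n i := hj ▸ mem_image_of_mem _ hx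
      have := eq_of_mk_eq hi (transl_fix g n i k hi hk) hy hx hyx
      have e := openCell_eq_of_mem hx (this ▸ hy)
      rw [Sigma.mk.injEq] at e
      exact eq_of_heq e.2
    rw [hij]
    rintro _ ⟨x, hx, rfl⟩
    exact congrArg (mk q) (hX.fixes_pointwise g n k hk x hx)

variable {Φ : X → C(I, X)} (hΦ : Continuous Φ) (hΦ0 : ∀ x, Φ x 0 = x)
  (hΦq : ∀ x, q x ∈ zeroCells X → Φ x 1 = q x ∧ ∀ t, q (Φ x t) = q x)
include hΦ hΦ0 hΦq

-- By `hΦq` the homotopy keeps the fibre inside itself and ends at `r`, so it restricts to a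
-- contraction of the fibre.
omit hq in
lemma contractibleSpace_fiber {r : X} (hr : r ∈ zeroCells X) (hqr : q r = r) :
    ContractibleSpace (mk q ⁻¹' {mk q r}) := by
  have mem (x : X) : x ∈ mk q ⁻¹' {mk q r} ↔ q x = r := by
    rw [mem_preimage, mem_singleton_iff, mk_eq_mk, hqr]
  have h (x : X) (hx : x ∈ mk q ⁻¹' {mk q r}) : Φ x 1 = r ∧ ∀ t, q (Φ x t) = r := by
    rw [mem] at hx
    rw [← hx]
    exact hΦq x (hx ▸ hr)
  rw [contractible_iff_id_nullhomotopic]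
  refine ⟨⟨r, (mem r).2 hqr⟩, ⟨⟨⟨fun p => ⟨Φ p.2 p.1, (mem _).2 ((h _ p.2.2).2 _)⟩, ?_⟩,
    fun x => Subtype.ext (hΦ0 x), fun x => Subtype.ext (h x x.2).1⟩⟩⟩
  fun_prop

-- This is what lets the homotopy descend to the quotient. Distinct points with the same image lie
-- over a `0`-cell; there both tracks end at the root and project to a constant path.
omit hΦ hΦ0 in
lemma eq_of_q_eq {x y : X} (h : q x = q y) :
    Φ x 1 = Φ y 1 ∧ ∀ t, mk q (Φ x t) = mk q (Φ y t) := by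
  by_cases hx : q x ∈ zeroCells X
  · have h₁ := hΦq x hx
    have h₂ := hΦq y (h ▸ hx)
    exact ⟨by rw [h₁.1, h₂.1, h], fun t => mk_eq_mk.2 (by rw [h₁.2, h₂.2, h])⟩
  · have h₁ := (hq.eq_or_mem x).resolve_right fun h' => hx h'.1
    have h₂ := (hq.eq_or_mem y).resolve_right fun h' => hx (h ▸ h'.1)
    obtain rfl : x = y := by rw [← h₁, ← h₂, h]
    exact ⟨rfl, fun t => rfl⟩

/-- The collapse restricts to a homotopy equivalence on fixed point sets which are preserved by a
homotopy from the identity to a map which is constant on the collapsed subcomplexes. -/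
lemma exists_homotopyEquiv_fixedPoints (heq : ∀ (g : G) x, q (g • x) = g • q x) (H : Subgroup G)
    (hΦH : ∀ x ∈ MulAction.fixedPoints H X, ∀ t, Φ x t ∈ MulAction.fixedPoints H X) :
    letI := mulAction heq
    ∃ e : ContinuousMap.HomotopyEquiv (MulAction.fixedPoints H X)
      (MulAction.fixedPoints H (CollapseQuotient q)),
        ∀ x : MulAction.fixedPoints H X, (e x : CollapseQuotient q) = mk q x := by
  let := mulAction heq
  have cmk : Continuous (mk q) := isQuotientMap_mk.continuous
  -- The homotopy inverse is induced by the end of the homotopy, and `Ψ` below is the homotopy that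
  -- `Φ` induces on the quotient.
  let g : CollapseQuotient q → X := Quotient.lift (fun x => Φ x 1)
    fun x y h => (hq.eq_of_q_eq hΦq h).1
  have cg : Continuous g := isQuotientMap_mk.continuous_iff.2 <| by
    change Continuous fun x => Φ x 1
    fun_prop
  let Ψ : CollapseQuotient q → C(I, CollapseQuotient q) :=
    Quotient.lift (fun x => (ContinuousMap.mk _ cmk).comp (Φ x)) fun x y h =>
      ContinuousMap.ext (hq.eq_of_q_eq hΦq h).2
  have cΨ : Continuous Ψ := isQuotientMap_mk.continuous_iff.2 <| by
    change Continuous fun x => (ContinuousMap.mk _ cmk).comp (Φ x)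
    fun_prop
  have mkH (x : X) (hx : x ∈ MulAction.fixedPoints H X) :
      mk q x ∈ MulAction.fixedPoints H (CollapseQuotient q) := fun h =>
    congrArg (mk q) (hx h)
  -- An arbitrary preimage of a fixed point need not be fixed, but the canonical representative `q
  -- x` is, by equivariance of `q`.
  have surjH (y : CollapseQuotient q) (hy : y ∈ MulAction.fixedPoints H (CollapseQuotient q)) :
      ∃ x ∈ MulAction.fixedPoints H X, mk q x = y := by
    obtain ⟨x, rfl⟩ := mk_surjective y
    exact ⟨q x, fun h => (smul_mk_eq_iff heq (h : G) x).1 (hy h), hq.mk_apply x⟩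
  have gH (y : CollapseQuotient q) (hy : y ∈ MulAction.fixedPoints H (CollapseQuotient q)) :
      g y ∈ MulAction.fixedPoints H X := by
    obtain ⟨x, hx, rfl⟩ := surjH y hy
    exact hΦH x hx 1
  have ΨH (y : CollapseQuotient q) (hy : y ∈ MulAction.fixedPoints H (CollapseQuotient q))
      (t : I) : Ψ y t ∈ MulAction.fixedPoints H (CollapseQuotient q) := by
    obtain ⟨x, hx, rfl⟩ := surjH y hy
    exact mkH _ (hΦH x hx t)
  refine ⟨⟨⟨fun x => ⟨mk q x, mkH x x.2⟩, by fun_prop⟩, ⟨fun y => ⟨g y, gH y y.2⟩, by fun_prop⟩,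
    ?_, ?_⟩, fun x => rfl⟩
  · symm
    refine ⟨⟨⟨fun p => ⟨Φ p.2 p.1, hΦH _ p.2.2 _⟩, by fun_prop⟩,
      fun x => Subtype.ext (hΦ0 x), fun x => Subtype.ext rfl⟩⟩
  · symm
    refine ⟨⟨⟨fun p => ⟨Ψ p.2 p.1, ΨH _ p.2.2 _⟩, by fun_prop⟩, ?_, ?_⟩⟩
    · rintro ⟨y, hy⟩
      obtain ⟨x, rfl⟩ := mk_surjective y
      exact Subtype.ext (congrArg (mk q) (hΦ0 x))
    · rintro ⟨y, hy⟩
      obtain ⟨x, rfl⟩ := mk_surjective y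
      exact Subtype.ext rfl

end IsCellCollapse

end EquivariantCollapse

/-! ### From a collapse with a compatible homotopy to the conclusions. -/

section Assembly
open RelCWComplex unitInterval CollapseQuotient

/-- Reduces the theorem to constructing, on `X` itself, an equivariant collapse `q` and a homotopy
`Φ` that contracts its fibres over `0`-cells and preserves all fixed point sets. -/
theorem exists_quotient_of_collapse {G : Type v} [Group G] (F : Set (Subgroup G))
    (X : Type u) [TopologicalSpace X] [T2Space X] [MulAction G X]
    [CWComplex (univ : Set X)] (hX : IsModelEFG F X) {q : X → X} (hq : IsCellCollapse q)
    (hq1 : ∀ n, 1 < n → ∀ i : cell (univ : Set X) n, ∀ x ∈ openCell n i, q x = x)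
    (heq : ∀ (g : G) x, q (g • x) = g • q x)
    (hfin : ((MulAction.orbit G : X → Set X) '' {r | r ∈ zeroCells X ∧ q r = r}).Finite)
    (hmax : ∀ r ∈ zeroCells X, q r = r → Maximal (· ∈ F) (MulAction.stabilizer G r))
    {Φ : X → C(I, X)} (hΦ : Continuous Φ) (hΦ0 : ∀ x, Φ x 0 = x)
    (hΦq : ∀ x, q x ∈ zeroCells X → Φ x 1 = q x ∧ ∀ t, q (Φ x t) = q x)
    (hΦH : ∀ H : Subgroup G, ∀ x ∈ MulAction.fixedPoints H X, ∀ t,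
      Φ x t ∈ MulAction.fixedPoints H X) :
    ∃ (Y : Type u) (_ : TopologicalSpace Y) (_ : T2Space Y) (_ : MulAction G Y)
      (_ : CWComplex (univ : Set Y)) (f : X → Y),
      IsGCWComplex G Y ∧
      (IsQuotientMap f ∧ ∀ (g : G) (x : X), f (g • x) = g • f x) ∧
      ((MulAction.orbit G : Y → Set Y) '' zeroCells Y).Finite ∧
      (∀ y ∈ zeroCells Y, Maximal (· ∈ F) (MulAction.stabilizer G y)) ∧
      (∀ y : Y, MulAction.stabilizer G y ∈ F) ∧
      (∀ y ∈ zeroCells Y, ContractibleSpace (f ⁻¹' {y}) ∧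
        ∃ T : RelCWComplex.Subcomplex (univ : Set X),
          (T : Set X) = f ⁻¹' {y} ∧ T ≤ RelCWComplex.skeleton (univ : Set X) 1) ∧
      (∀ k : ℕ, 1 < k → ∀ i : RelCWComplex.cell (univ : Set X) k,
        ∃ j : RelCWComplex.cell (univ : Set Y) k,
          f '' RelCWComplex.openCell k i = RelCWComplex.openCell k j ∧
          IsEmbedding ((RelCWComplex.openCell k i).domRestrict f)) ∧
      (∀ H ∈ F, ∃ e : ContinuousMap.HomotopyEquiv (MulAction.fixedPoints H X)
          (MulAction.fixedPoints H Y),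
        ∀ x : MulAction.fixedPoints H X, (e x : Y) = f x) := by
  let := mulAction heq
  have := hq.t2Space
  let := hq.cwComplex
  refine ⟨CollapseQuotient q, inferInstance, inferInstance, inferInstance, inferInstance, mk q,
    hq.isGCWComplex hX.isGCWComplex heq, ⟨IsCellCollapse.isQuotientMap_mk, fun g x => rfl⟩,
    ?_, ?_, ?_, ?_, ?_, ?_⟩
  · have orb (x : X) : MulAction.orbit G (mk q x) = mk q '' MulAction.orbit G x := by
      ext y
      simp only [MulAction.mem_orbit_iff, mem_image, exists_exists_eq_and]
      rfl
    refine (hfin.image (image (mk q))).subset ?_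
    rintro _ ⟨y, hy, rfl⟩
    obtain ⟨r, hr, hr', rfl⟩ := hq.mem_zeroCells_mk.1 hy
    exact ⟨_, ⟨r, ⟨hr, hr'⟩, rfl⟩, (orb r).symm⟩
  · intro y hy
    obtain ⟨r, hr, hr', rfl⟩ := hq.mem_zeroCells_mk.1 hy
    rw [IsCellCollapse.stabilizer_mk heq, hr']
    exact hmax r hr hr'
  · intro y
    obtain ⟨x, rfl⟩ := IsCellCollapse.mk_surjective y
    rw [IsCellCollapse.stabilizer_mk heq]
    exact hX.stabilizer_mem _
  · intro y hy
    obtain ⟨r, hr, hr', rfl⟩ := hq.mem_zeroCells_mk.1 hy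
    refine ⟨IsCellCollapse.contractibleSpace_fiber hΦ hΦ0 hΦq hr hr', ?_⟩
    have fib : mk q ⁻¹' {mk q r} = q ⁻¹' {r} := by
      ext x
      rw [mem_preimage, mem_singleton_iff, IsCellCollapse.mk_eq_mk, hr']
      rfl
    obtain ⟨T, hT⟩ := hq.exists_subcomplex {r} (by rintro _ rfl; exact ⟨hr, hr'⟩)
    refine ⟨T, hT.trans fib.symm, fun x hx => ?_⟩
    have hx : q x = r := by
      have : x ∈ (T : Set X) := hx
      rwa [hT] at this
    have e : (skeleton (univ : Set X) 1) = skeletonLT (univ : Set X) (2 : ℕ) := by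
      simp [skeleton, one_add_one_eq_two]
    rw [e, mem_skeletonLT_iff_openCell]
    obtain ⟨n, i, hi⟩ := exists_mem_openCell (mem_univ x)
    refine ⟨n, ?_, i, hi⟩
    -- On a cell of dimension at least `2` the map `q` is the identity, so no point of it is sent to
    -- a `0`-cell.
    by_contra hn
    have := hq1 n (by omega) i x hi
    have := eq_zero_of_mem_zeroCells hi (x := x) (by rw [← this, hx]; exact hr)
    omega
  · intro k hk i
    obtain ⟨j, hj⟩ := hq.exists_openCell_eq_image (hq1 k hk i)
    exact ⟨j, hj.symm, hq.isEmbedding_restrict (hq1 k hk i)⟩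
  · intro H hH
    exact hq.exists_homotopyEquiv_fixedPoints hΦ hΦ0 hΦq heq H (hΦH H)

end Assembly

/-! ### Edges as paths, and the action on cells. -/

section EdgePaths
open RelCWComplex unitInterval

variable {X : Type u} [TopologicalSpace X] [T2Space X] [CWComplex (univ : Set X)]

/-- A path which parametrizes a `1`-cell. -/
def IsEdgePath (η : C(I, X)) (e : cell (univ : Set X) 1) : Prop :=
  InjOn η (Ioo 0 1) ∧ η '' Ioo 0 1 = openCell 1 e ∧ {η 0, η 1} = cellFrontier 1 e

namespace IsEdgePath

variable {η : C(I, X)} {e : cell (univ : Set X) 1} (hη : IsEdgePath η e)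
include hη

lemma apply_mem_zeroCells : η 0 ∈ zeroCells X ∧ η 1 ∈ zeroCells X := by
  have : cellFrontier 1 e ⊆ zeroCells X := fun x hx => by
    obtain ⟨m, hm, i, hi⟩ :=
      mem_skeletonLT_iff_openCell.1 (cellFrontier_subset_skeletonLT _ e hx)
    obtain rfl : m = 0 := by omega
    exact mem_zeroCells.2 ⟨i, hi⟩
  rw [← hη.2.2] at this
  exact ⟨this (by simp), this (by simp)⟩

omit [T2Space X] in
lemma range_eq : range η = closedCell 1 e := by
  rw [← cellFrontier_union_openCell_eq_closedCell, ← hη.2.1, ← hη.2.2]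
  ext x
  constructor
  · rintro ⟨t, rfl⟩
    rcases t.2.1.eq_or_lt with h | h
    · exact Or.inl (Or.inl (congrArg η (Subtype.ext h.symm)))
    rcases t.2.2.eq_or_lt with h' | h'
    · exact Or.inl (Or.inr (congrArg η (Subtype.ext h')))
    · exact Or.inr ⟨t, ⟨h, h'⟩, rfl⟩
  · rintro ((rfl | rfl) | ⟨t, -, rfl⟩) <;> exact mem_range_self _

omit [T2Space X] in
lemma mem_openCell {s : I} (hs : s ∈ Ioo 0 1) : η s ∈ openCell 1 e :=
  hη.2.1 ▸ mem_image_of_mem _ hs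

end IsEdgePath

omit [T2Space X] in
lemma exists_isEdgePath (e : cell (univ : Set X) 1) {x y : X} (hx : x ∈ cellFrontier 1 e)
    (hy : y ∈ cellFrontier 1 e) (hxy : x ≠ y) :
    ∃ η : C(I, X), IsEdgePath η e ∧ η 0 = x ∧ η 1 = y := by
  -- The sign `a` chooses the direction in which the edge is traversed.
  have key (a : ℝ) (ha : a = 1 ∨ a = -1) : ∃ η : C(I, X), IsEdgePath η e ∧
      η 0 = map 1 e (fun _ => -a) ∧ η 1 = map 1 e (fun _ => a) := by
    have habs : |a| = 1 := by rcases ha with rfl | rfl <;> simp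
    let p (t : I) : Fin 1 → ℝ := fun _ => a * (2 * t - 1)
    have hp (t : I) : ‖p t‖ = |2 * (t : ℝ) - 1| := by
      rw [pi_norm_const, Real.norm_eq_abs, abs_mul, habs, one_mul]
    have hpc (t : I) : p t ∈ Metric.closedBall (0 : Fin 1 → ℝ) 1 := by
      rw [mem_closedBall_zero_iff, hp, abs_le]
      constructor <;> linarith [t.2.1, t.2.2]
    have hpb (t : I) : p t ∈ Metric.ball (0 : Fin 1 → ℝ) 1 ↔ t ∈ Ioo 0 1 := by
      rw [mem_ball_zero_iff, hp, abs_lt, mem_Ioo, ← Subtype.coe_lt_coe, ← Subtype.coe_lt_coe]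
      constructor
      · rintro ⟨h, h'⟩
        exact ⟨by change (0 : ℝ) < t; linarith, by change (t : ℝ) < 1; linarith⟩
      · rintro ⟨h, h'⟩
        have h : (0 : ℝ) < t := h
        have h' : (t : ℝ) < 1 := h'
        constructor <;> linarith
    have h0 : p 0 = fun _ => -a := by ext; simp [p]
    have h1 : p 1 = fun _ => a := by
      ext
      simp only [p, Icc.coe_one]
      ring
    let η : C(I, X) := ⟨fun t => map 1 e (p t),
      (continuousOn 1 e).comp_continuous (by fun_prop) hpc⟩
    refine ⟨η, ⟨?_, ?_, ?_⟩, congrArg _ h0, congrArg _ h1⟩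
    · intro s hs t ht hst
      have := (map 1 e).injOn (by rw [source_eq]; exact (hpb s).2 hs)
        (by rw [source_eq]; exact (hpb t).2 ht) hst
      have := congrFun this 0
      have ha0 : a ≠ 0 := by rcases ha with rfl | rfl <;> norm_num
      have := mul_left_cancel₀ ha0 this
      exact Subtype.ext (by linarith)
    · apply subset_antisymm
      · rintro _ ⟨t, ht, rfl⟩
        exact mem_image_of_mem _ ((hpb t).2 ht)
      · rintro _ ⟨z, hz, rfl⟩
        have hz' := hz
        have ez : z = fun _ => z 0 := by ext i; rw [Subsingleton.elim i 0]
        rw [ez, mem_ball_zero_iff, pi_norm_const, Real.norm_eq_abs] at hz'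
        have hb : |a * z 0| < 1 := by rwa [abs_mul, habs, one_mul]
        rw [abs_lt] at hb
        let t : I := ⟨(1 + a * z 0) / 2, by constructor <;> linarith⟩
        have ept : p t = z := by
          ext i
          rw [Subsingleton.elim i 0]
          change a * (2 * ((1 + a * z 0) / 2) - 1) = z 0
          rcases ha with rfl | rfl <;> ring
        refine ⟨t, ?_, congrArg _ ept⟩
        rw [← hpb, ept]
        exact hz
    · rw [cellFrontier_one_eq, image_pair]
      change {map 1 e (p 0), map 1 e (p 1)} = _
      rw [h0, h1]
      rcases ha with rfl | rfl
      · rfl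
      · rw [pair_comm, neg_neg]
        rfl
  rw [cellFrontier_one_eq, image_pair] at hx hy
  rcases hx with rfl | rfl <;> rcases hy with rfl | rfl
  · exact absurd rfl hxy
  · exact key 1 (Or.inl rfl)
  · obtain ⟨η, h, h0, h1⟩ := key (-1) (Or.inr rfl)
    exact ⟨η, h, by rw [h0, neg_neg]; rfl, h1⟩
  · exact absurd rfl hxy

variable {G : Type v} [Group G] [MulAction G X] (hX : IsGCWComplex G X)
include hX

namespace IsGCWComplex

lemma smul_closedCell {g : G} {n : ℕ} {i j : cell (univ : Set X) n}
    (h : (fun x : X => g • x) '' openCell n i = openCell n j) :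
    (fun x : X => g • x) '' closedCell n i = closedCell n j := by
  have := hX.continuousConstSMul
  rw [← closure_openCell_eq_closedCell, ← closure_openCell_eq_closedCell, ← h]
  exact (Homeomorph.smul g).image_closure _

lemma smul_cellFrontier {g : G} {n : ℕ} {i j : cell (univ : Set X) n}
    (h : (fun x : X => g • x) '' openCell n i = openCell n j) :
    (fun x : X => g • x) '' cellFrontier n i = cellFrontier n j := by
  have key (i : cell (univ : Set X) n) : cellFrontier n i = closedCell n i \ openCell n i := by
    rw [← cellFrontier_union_openCell_eq_closedCell, union_sdiff_right,
      (disjoint_cellFrontier_openCell i i).sdiff_eq_left]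
  rw [key, key, image_sdiff (MulAction.injective g), h, hX.smul_closedCell h]

lemma smul_mem_zeroCells (g : G) {x : X} (hx : x ∈ zeroCells X) : g • x ∈ zeroCells X := by
  obtain ⟨i, hi⟩ := mem_zeroCells.1 hx
  obtain ⟨j, hj⟩ := hX.cellular g 0 i
  exact mem_zeroCells.2 ⟨j, hj ▸ mem_image_of_mem _ hi⟩

lemma smul_mem_zeroCells_iff (g : G) {x : X} : g • x ∈ zeroCells X ↔ x ∈ zeroCells X :=
  ⟨fun h => by simpa using hX.smul_mem_zeroCells g⁻¹ h, hX.smul_mem_zeroCells g⟩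

lemma smul_eq_of_mem_closedCell {g : G} {n : ℕ} {i : cell (univ : Set X) n} {x : X}
    (hx : x ∈ openCell n i) (hgx : g • x = x) {y : X} (hy : y ∈ closedCell n i) : g • y = y := by
  have := hX.continuousConstSMul
  obtain ⟨j, hj⟩ := hX.cellular g n i
  obtain rfl : j = i := by
    have hx' : x ∈ openCell n j := by
      rw [← hj, ← hgx]
      exact mem_image_of_mem _ hx
    simpa using openCell_eq_of_mem hx' hx
  have closed : IsClosed {y : X | g • y = y} := isClosed_eq (continuous_const_smul g) continuous_id
  rw [← closure_openCell_eq_closedCell] at hy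
  exact closed.closure_subset_iff.2 (hX.fixes_pointwise g n j hj) hy

lemma isEdgePath_smul (g : G) {η τ : C(I, X)} {e : cell (univ : Set X) 1} (hη : IsEdgePath η e)
    (hτ : ∀ t, τ t = g • η t) : ∃ e', IsEdgePath τ e' := by
  obtain ⟨e', he'⟩ := hX.cellular g 1 e
  refine ⟨e', fun s hs t ht hst => ?_, ?_, ?_⟩
  · rw [hτ, hτ] at hst
    exact hη.1 hs ht (MulAction.injective g hst)
  · rw [← he', ← hη.2.1, image_image]
    exact image_congr fun t _ => hτ t
  · rw [← hX.smul_cellFrontier he', ← hη.2.2, image_pair, hτ, hτ]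

/-- The fixed point set of a subgroup is a subcomplex. -/
lemma exists_subcomplex_fixedPoints (H : Subgroup G) :
    ∃ T : Subcomplex (univ : Set X), (T : Set X) = MulAction.fixedPoints H X := by
  refine ⟨CWComplex.Subcomplex.mk' _ (MulAction.fixedPoints H X)
    (fun n => {i | closedCell n i ⊆ MulAction.fixedPoints H X}) (fun n i => i.2) ?_, rfl⟩
  ext x
  simp only [mem_iUnion]
  constructor
  · rintro ⟨n, i, hx⟩
    exact i.2 (openCell_subset_closedCell n _ hx)
  · intro h
    obtain ⟨n, i, hi⟩ := exists_mem_openCell (mem_univ x)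
    exact ⟨n, ⟨i, fun y hy g => hX.smul_eq_of_mem_closedCell (g := (g : G)) hi (h g) hy⟩, hi⟩

end IsGCWComplex

end EdgePaths

/-! ### Concatenation of paths and their tails. -/

section PathConcatenation
open unitInterval

/-- The map `s ↦ s / 2 + t (1 - s / 2)`, as a family of maps in the variable `t`. -/
noncomputable def slide : C(I, C(I, I)) := ContinuousMap.curry
  ⟨fun p => ⟨(p.1 : ℝ) / 2 + p.2 * (1 - p.1 / 2), by
    have h₁ := p.1.2.1
    have h₂ := p.1.2.2
    have h₃ := p.2.2.1
    have h₄ := p.2.2.2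
    constructor
    · have : 0 ≤ (p.2 : ℝ) * (1 - p.1 / 2) := mul_nonneg h₃ (by linarith)
      linarith
    · have : (p.2 : ℝ) * (1 - p.1 / 2) ≤ 1 * (1 - p.1 / 2) :=
        mul_le_mul_of_nonneg_right h₄ (by linarith)
      linarith⟩, by fun_prop⟩

lemma coe_slide (s t : I) : (slide s t : ℝ) = s / 2 + t * (1 - s / 2) := rfl

lemma slide_one (s : I) : slide s 1 = 1 := Subtype.ext (by rw [coe_slide]; simp)

lemma slide_zero_left (t : I) : slide 0 t = t := Subtype.ext (by rw [coe_slide]; simp)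

/-- `slide s 0 = s/2` and `slide 1 s = (1 + s)/2` parametrize the two halves of the interval, so
identities about a concatenation can be checked on each half. -/
lemma eq_slide (t : I) : (∃ s, t = slide s 0) ∨ ∃ s, t = slide 1 s := by
  rcases le_total (t : ℝ) (1 / 2) with h | h
  · refine Or.inl ⟨⟨2 * t, by constructor <;> linarith [t.2.1]⟩, Subtype.ext ?_⟩
    rw [coe_slide]
    simp
  · refine Or.inr ⟨⟨2 * t - 1, by constructor <;> linarith [t.2.2]⟩, Subtype.ext ?_⟩
    rw [coe_slide]
    simp only [Icc.coe_one]
    ring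

variable {X : Type u} [TopologicalSpace X]

lemma exists_concat {a b : C(I, X)} (h : a 1 = b 0) :
    ∃ c : C(I, X), ∀ s, c (slide s 0) = a s ∧ c (slide 1 s) = b s := by
  let α : Path (a 0) (a 1) := ⟨a, rfl, rfl⟩
  let β : Path (a 1) (b 1) := ⟨b, h.symm, rfl⟩
  refine ⟨(α.trans β).toContinuousMap, fun s => ⟨?_, ?_⟩⟩
  · change (α.trans β) _ = _
    have hs : ((slide s 0 : I) : ℝ) ≤ 1 / 2 := by
      rw [coe_slide]
      have := s.2.2
      simp only [Icc.coe_zero]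
      linarith
    rw [Path.trans_apply, dif_pos hs]
    refine congrArg a (Subtype.ext ?_)
    change 2 * ((slide s 0 : I) : ℝ) = s
    rw [coe_slide]
    simp only [Icc.coe_zero]
    ring
  · change (α.trans β) _ = _
    rw [Path.trans_apply]
    split_ifs with hs
    · rw [coe_slide] at hs
      have hs0 : s = 0 := by
        have := s.2.1
        simp only [Icc.coe_one] at hs
        exact Subtype.ext (by change (s : ℝ) = 0; linarith)
      subst hs0
      rw [← h]
      refine congrArg a (Subtype.ext ?_)
      change 2 * ((slide 1 0 : I) : ℝ) = 1
      rw [coe_slide]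
      simp
    · refine congrArg b (Subtype.ext ?_)
      change 2 * ((slide 1 s : I) : ℝ) - 1 = s
      rw [coe_slide]
      simp only [Icc.coe_one]
      ring

open Classical in
/-- The concatenation of two paths (a junk value if they are not composable). -/
noncomputable def concatPath (a b : C(I, X)) : C(I, X) :=
  if h : a 1 = b 0 then (exists_concat h).choose else a

lemma concatPath_apply {a b : C(I, X)} (h : a 1 = b 0) (s : I) :
    concatPath a b (slide s 0) = a s ∧ concatPath a b (slide 1 s) = b s := by
  rw [concatPath, dif_pos h]
  exact (exists_concat h).choose_spec s

end PathConcatenation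

/-! ### Equivariant rooted forests and their contraction. -/

section Forest
open RelCWComplex unitInterval

variable {G : Type v} [Group G] {X : Type u} [TopologicalSpace X] [T2Space X] [MulAction G X]
  [CWComplex (univ : Set X)]

variable (G) in
/-- An equivariant forest in the `1`-skeleton containing all `0`-cells, in which every component
has a root, the only vertex of depth `0`: every other vertex `v` comes with the edge path `edge v`
to the next vertex on the way from `v` to the root. -/
structure IsRootedForest (depth : X → ℕ) (edge : X → C(I, X)) : Prop where
  isEdgePath : ∀ v ∈ zeroCells X, depth v ≠ 0 → ∃ e, IsEdgePath (edge v) e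
  edge_zero : ∀ v ∈ zeroCells X, depth v ≠ 0 → edge v 0 = v
  depth_edge_one : ∀ v ∈ zeroCells X, depth v ≠ 0 → depth (edge v 1) + 1 = depth v
  depth_smul : ∀ v ∈ zeroCells X, ∀ g : G, depth (g • v) = depth v
  edge_smul : ∀ v ∈ zeroCells X, depth v ≠ 0 → ∀ (g : G) t, edge (g • v) t = g • edge v t

/-- The path of length `n` starting at `v` in a rooted forest. -/
noncomputable def pathOfLength (edge : X → C(I, X)) : ℕ → X → C(I, X)
  | 0, v => ContinuousMap.const I v
  | n + 1, v => concatPath (edge v) (pathOfLength edge n (edge v 1))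

/-- The path from the vertex `v` to the root of its component. -/
noncomputable def rootPath (depth : X → ℕ) (edge : X → C(I, X)) (v : X) : C(I, X) :=
  pathOfLength edge (depth v) v

open Classical in
/-- The contraction of a rooted forest to its roots, extended by constant paths. -/
noncomputable def forestContraction (depth : X → ℕ) (edge : X → C(I, X)) (x : X) : C(I, X) :=
  if x ∈ zeroCells X then rootPath depth edge x else
    if h : ∃ p : X × I, p.1 ∈ zeroCells X ∧ depth p.1 ≠ 0 ∧ p.2 ∈ Ioo 0 1 ∧ edge p.1 p.2 = x then
      -- The root path runs along the first edge during `[0, 1/2]`, so it passes the point with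
      -- parameter `s` at time `s/2`; `slide s` selects the tail from there on.
      (rootPath depth edge h.choose.1).comp (slide h.choose.2)
    else ContinuousMap.const I x

namespace IsRootedForest

variable {depth : X → ℕ} {edge : X → C(I, X)} (hf : IsRootedForest G depth edge)
include hf

lemma edge_one_mem {v : X} (hv : v ∈ zeroCells X) (h : depth v ≠ 0) :
    edge v 1 ∈ zeroCells X := (hf.isEdgePath v hv h).choose_spec.apply_mem_zeroCells.2

omit hf [T2Space X] [CWComplex (univ : Set X)] in
lemma rootPath_of_depth_eq_zero {v : X} (h : depth v = 0) :
    rootPath depth edge v = ContinuousMap.const I v := by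
  rw [rootPath, h]
  rfl

/-- Induction along the paths to the roots. -/
lemma induction_depth {p : X → Prop} (root : ∀ v ∈ zeroCells X, depth v = 0 → p v)
    (step : ∀ v ∈ zeroCells X, depth v ≠ 0 → p (edge v 1) → p v) :
    ∀ v ∈ zeroCells X, p v := by
  intro v hv
  induction hn : depth v generalizing v with
  | zero => exact root v hv hn
  | succ n ih =>
    have h : depth v ≠ 0 := by omega
    have := hf.depth_edge_one v hv h
    exact step v hv h (ih _ (hf.edge_one_mem hv h) (by omega))

lemma rootPath_eq {v : X} (hv : v ∈ zeroCells X) (h : depth v ≠ 0) :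
    rootPath depth edge v = concatPath (edge v) (rootPath depth edge (edge v 1)) := by
  -- With the length written as a successor, the recursion for `pathOfLength` unfolds by definition.
  conv_lhs => rw [rootPath, ← hf.depth_edge_one v hv h]
  rfl

lemma rootPath_zero : ∀ v ∈ zeroCells X, rootPath depth edge v 0 = v := by
  refine hf.induction_depth (fun v hv h => ?_) fun v hv h ih => ?_
  · rw [rootPath_of_depth_eq_zero h]
    rfl
  · rw [hf.rootPath_eq hv h]
    have := (concatPath_apply ih.symm 0).1
    rwa [slide_zero_left, hf.edge_zero v hv h] at this

lemma rootPath_slide {v : X} (hv : v ∈ zeroCells X) (h : depth v ≠ 0) (s : I) :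
    rootPath depth edge v (slide s 0) = edge v s ∧
      rootPath depth edge v (slide 1 s) = rootPath depth edge (edge v 1) s := by
  rw [hf.rootPath_eq hv h]
  exact concatPath_apply (hf.rootPath_zero _ (hf.edge_one_mem hv h)).symm s

lemma rootPath_one {v : X} (hv : v ∈ zeroCells X) (h : depth v ≠ 0) :
    rootPath depth edge v 1 = rootPath depth edge (edge v 1) 1 := by
  rw [← (hf.rootPath_slide hv h 1).2, slide_one]

lemma rootPath_one_mem : ∀ v ∈ zeroCells X,
    rootPath depth edge v 1 ∈ zeroCells X ∧ depth (rootPath depth edge v 1) = 0 := by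
  refine hf.induction_depth (fun v hv h => ?_) fun v hv h ih => ?_
  · rw [rootPath_of_depth_eq_zero h]
    exact ⟨hv, h⟩
  · rwa [hf.rootPath_one hv h]

lemma depth_smul_ne {v : X} (hv : v ∈ zeroCells X) (h : depth v ≠ 0) (g : G) :
    depth (g • v) ≠ 0 := by rwa [hf.depth_smul v hv]

lemma rootPath_smul (hX : IsGCWComplex G X) (g : G) : ∀ v ∈ zeroCells X,
    ∀ t, rootPath depth edge (g • v) t = g • rootPath depth edge v t := by
  refine hf.induction_depth (fun v hv h t => ?_) fun v hv h ih t => ?_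
  · rw [rootPath_of_depth_eq_zero h, rootPath_of_depth_eq_zero (by rwa [hf.depth_smul v hv])]
    rfl
  · have hv' := hX.smul_mem_zeroCells g hv
    have h' := hf.depth_smul_ne hv h g
    rcases eq_slide t with ⟨s, rfl⟩ | ⟨s, rfl⟩
    · rw [(hf.rootPath_slide hv h s).1, (hf.rootPath_slide hv' h' s).1, hf.edge_smul v hv h]
    · rw [(hf.rootPath_slide hv h s).2, (hf.rootPath_slide hv' h' s).2, hf.edge_smul v hv h, ih]

/-- Points in the interior of an edge of the forest determine the edge. -/
lemma edge_injective {v w : X} (hv : v ∈ zeroCells X) (hw : w ∈ zeroCells X) (hdv : depth v ≠ 0)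
    (hdw : depth w ≠ 0) {s t : I} (hs : s ∈ Ioo 0 1) (ht : t ∈ Ioo 0 1)
    (h : edge v s = edge w t) : v = w ∧ s = t := by
  obtain ⟨e, he⟩ := hf.isEdgePath v hv hdv
  obtain ⟨e', he'⟩ := hf.isEdgePath w hw hdw
  obtain rfl : e = e' := by
    have := openCell_eq_of_mem (h ▸ he.mem_openCell hs) (he'.mem_openCell ht)
    rw [Sigma.mk.injEq] at this
    exact eq_of_heq this.2
  have front : ({v, edge v 1} : Set X) = {w, edge w 1} := by
    have h₁ := he.2.2
    have h₂ := he'.2.2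
    rw [hf.edge_zero v hv hdv] at h₁
    rw [hf.edge_zero w hw hdw] at h₂
    rw [h₁, h₂]
  -- If two different vertices had the same edge, each would be the next vertex after the other, but
  -- depth drops at every step.
  have hvw : v = w := by
    have dv := hf.depth_edge_one v hv hdv
    have dw := hf.depth_edge_one w hw hdw
    rcases (front ▸ mem_insert v _ : v ∈ ({w, edge w 1} : Set X)) with h₁ | h₁
    · exact h₁
    rcases (front ▸ mem_insert w _ : w ∈ ({v, edge v 1} : Set X)) with h₂ | h₂
    · exact h₂.symm
    have h₁ : v = edge w 1 := h₁
    have h₂ : w = edge v 1 := h₂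
    rw [← h₁] at dw
    rw [← h₂] at dv
    omega
  subst hvw
  exact ⟨rfl, he.1 hs ht h⟩

lemma edge_notMem {v : X} (hv : v ∈ zeroCells X) (h : depth v ≠ 0) {s : I} (hs : s ∈ Ioo 0 1) :
    edge v s ∉ zeroCells X := fun hmem => by
  obtain ⟨e, he⟩ := hf.isEdgePath v hv h
  exact absurd (eq_zero_of_mem_zeroCells (he.mem_openCell hs) hmem) one_ne_zero

omit hf in
lemma contraction_vertex {v : X} (hv : v ∈ zeroCells X) :
    forestContraction depth edge v = rootPath depth edge v := if_pos hv

/-- The formula also holds at the ends `s = 0` and `s = 1`, where the definition takes its vertex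
branch; hence the contraction is continuous along closed edges. -/
lemma contraction_edge {v : X} (hv : v ∈ zeroCells X) (h : depth v ≠ 0) (s : I) :
    forestContraction depth edge (edge v s) = (rootPath depth edge v).comp (slide s) := by
  rcases s.2.1.eq_or_lt with h0 | h0
  · obtain rfl : s = 0 := Subtype.ext h0.symm
    rw [hf.edge_zero v hv h, contraction_vertex hv]
    ext t
    rw [ContinuousMap.comp_apply, slide_zero_left]
  rcases s.2.2.eq_or_lt with h1 | h1
  · obtain rfl : s = 1 := Subtype.ext h1
    rw [contraction_vertex (hf.edge_one_mem hv h)]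
    ext t
    exact (hf.rootPath_slide hv h t).2.symm
  have hs : s ∈ Ioo 0 1 := ⟨h0, h1⟩
  have ex : ∃ p : X × I, p.1 ∈ zeroCells X ∧ depth p.1 ≠ 0 ∧ p.2 ∈ Ioo 0 1 ∧
      edge p.1 p.2 = edge v s := ⟨(v, s), hv, h, hs, rfl⟩
  rw [forestContraction, if_neg (hf.edge_notMem hv h hs), dif_pos ex]
  have sp := ex.choose_spec
  obtain ⟨e₁, e₂⟩ := hf.edge_injective sp.1 hv sp.2.1 h sp.2.2.1 hs sp.2.2.2
  rw [e₁, e₂]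

omit hf in
lemma contraction_of_forall_ne {x : X} (hx : x ∉ zeroCells X)
    (h : ∀ v ∈ zeroCells X, depth v ≠ 0 → ∀ s ∈ Ioo 0 1, edge v s ≠ x) :
    forestContraction depth edge x = ContinuousMap.const I x := by
  rw [forestContraction, if_neg hx, dif_neg]
  rintro ⟨p, h₁, h₂, h₃, h₄⟩
  exact h _ h₁ h₂ _ h₃ h₄

omit hf in
/-- A point is a vertex, or a point in the interior of an edge of the forest, or not in the
forest. -/
lemma trichotomy (depth : X → ℕ) (edge : X → C(I, X)) (x : X) : x ∈ zeroCells X ∨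
    (∃ v ∈ zeroCells X, depth v ≠ 0 ∧ ∃ s ∈ Ioo (0 : I) 1, edge v s = x) ∨
      x ∉ zeroCells X ∧ ∀ v ∈ zeroCells X, depth v ≠ 0 → ∀ s ∈ Ioo 0 1, edge v s ≠ x := by
  by_cases h : x ∈ zeroCells X
  · exact Or.inl h
  by_cases h' : ∃ v ∈ zeroCells X, depth v ≠ 0 ∧ ∃ s ∈ Ioo (0 : I) 1, edge v s = x
  · exact Or.inr (Or.inl h')
  · exact Or.inr (Or.inr ⟨h, fun v hv hd s hs e => h' ⟨v, hv, hd, s, hs, e⟩⟩)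

lemma contraction_smul (hX : IsGCWComplex G X) (g : G) (x : X) (t : I) :
    forestContraction depth edge (g • x) t = g • forestContraction depth edge x t := by
  rcases trichotomy depth edge x with hx | ⟨v, hv, hd, s, hs, rfl⟩ | ⟨hx, h⟩
  · rw [contraction_vertex hx, contraction_vertex (hX.smul_mem_zeroCells g hx),
      hf.rootPath_smul hX g x hx]
  · rw [← hf.edge_smul v hv hd, hf.contraction_edge hv hd,
      hf.contraction_edge (hX.smul_mem_zeroCells g hv) (hf.depth_smul_ne hv hd g)]
    exact hf.rootPath_smul hX g v hv _
  · rw [contraction_of_forall_ne hx h, contraction_of_forall_ne]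
    · rfl
    · rwa [hX.smul_mem_zeroCells_iff]
    · intro v hv hd s hs e
      refine h _ (hX.smul_mem_zeroCells g⁻¹ hv) (hf.depth_smul_ne hv hd _) s hs ?_
      rw [hf.edge_smul v hv hd, e, inv_smul_smul]

lemma contraction_zero (x : X) : forestContraction depth edge x 0 = x := by
  rcases trichotomy depth edge x with hx | ⟨v, hv, hd, s, hs, rfl⟩ | ⟨hx, h⟩
  · rw [contraction_vertex hx, hf.rootPath_zero x hx]
  · rw [hf.contraction_edge hv hd]
    exact (hf.rootPath_slide hv hd s).1
  · rw [contraction_of_forall_ne hx h]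
    rfl

lemma contraction_edge_one {v : X} (hv : v ∈ zeroCells X) (h : depth v ≠ 0) (s : I) :
    forestContraction depth edge (edge v s) 1 = rootPath depth edge v 1 := by
  rw [hf.contraction_edge hv h, ContinuousMap.comp_apply, slide_one]

lemma contraction_rootPath_one : ∀ v ∈ zeroCells X, ∀ t,
    forestContraction depth edge (rootPath depth edge v t) 1 = rootPath depth edge v 1 := by
  refine hf.induction_depth (fun v hv h t => ?_) fun v hv h ih t => ?_
  · rw [rootPath_of_depth_eq_zero h]
    simp only [ContinuousMap.const_apply]
    rw [contraction_vertex hv, rootPath_of_depth_eq_zero h]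
    rfl
  · rcases eq_slide t with ⟨s, rfl⟩ | ⟨s, rfl⟩
    · rw [(hf.rootPath_slide hv h s).1, hf.contraction_edge_one hv h]
    · rw [(hf.rootPath_slide hv h s).2, ih, hf.rootPath_one hv h]

/-- A point moves only along its own path to the root, so its root never changes. Thus the homotopy
stays within the fibres of its end map. -/
lemma contraction_contraction (x : X) (t : I) :
    forestContraction depth edge (forestContraction depth edge x t) 1 =
      forestContraction depth edge x 1 := by
  rcases trichotomy depth edge x with hx | ⟨v, hv, hd, s, hs, rfl⟩ | ⟨hx, h⟩
  · rw [contraction_vertex hx, hf.contraction_rootPath_one x hx]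
  · rw [hf.contraction_edge_one hv hd, hf.contraction_edge hv hd]
    exact hf.contraction_rootPath_one v hv _
  · rw [contraction_of_forall_ne hx h]
    simp only [ContinuousMap.const_apply]
    rw [contraction_of_forall_ne hx h]
    rfl

/-- Every closed cell is either contained in the forest or its interior is disjoint from the
forest. -/
lemma cell_cases (n : ℕ) (i : cell (univ : Set X) n) :
    (ContinuousOn (forestContraction depth edge) (closedCell n i) ∧ n < 2 ∧
      ∃ r ∈ zeroCells X, depth r = 0 ∧
        ∀ x ∈ closedCell n i, forestContraction depth edge x 1 = r) ∨
    (n ≠ 0 ∧ ∀ x ∈ openCell n i, forestContraction depth edge x = ContinuousMap.const I x) := by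
  rcases n with _ | n
  · left
    have hv : map 0 i ![] ∈ zeroCells X :=
      mem_zeroCells.2 ⟨i, by rw [openCell_zero_eq_singleton]; rfl⟩
    rw [closedCell_zero_eq_singleton]
    refine ⟨continuousOn_singleton _ _, zero_lt_two, rootPath depth edge (map 0 i ![]) 1,
      (hf.rootPath_one_mem _ hv).1, (hf.rootPath_one_mem _ hv).2, ?_⟩
    rintro _ rfl
    rw [contraction_vertex hv]
  have notMem (x : X) (hx : x ∈ openCell (n + 1) i) : x ∉ zeroCells X := fun h =>
    absurd (eq_zero_of_mem_zeroCells hx h) n.succ_ne_zero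
  by_cases h : ∃ v ∈ zeroCells X, depth v ≠ 0 ∧ ∃ s ∈ Ioo (0 : I) 1, edge v s ∈ openCell (n + 1) i
  · obtain ⟨v, hv, hd, s, hs, hmem⟩ := h
    obtain ⟨e, he⟩ := hf.isEdgePath v hv hd
    have heq := openCell_eq_of_mem (he.mem_openCell hs) hmem
    obtain rfl : n = 0 := by
      simp only [Sigma.mk.injEq] at heq
      omega
    obtain rfl : e = i := by simpa using heq
    left
    refine ⟨?_, one_lt_two, _, (hf.rootPath_one_mem v hv).1, (hf.rootPath_one_mem v hv).2, ?_⟩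
    · change ContinuousOn _ (closedCell 1 e)
      rw [← he.range_eq, ← image_univ]
      refine isCompact_univ.continuousOn_image_of_comp (edge v).continuous.continuousOn ?_
      have : forestContraction depth edge ∘ edge v =
          fun s => (rootPath depth edge v).comp (slide s) :=
        funext fun s => hf.contraction_edge hv hd s
      rw [this]
      fun_prop
    · intro x hx
      obtain ⟨s, rfl⟩ : x ∈ range (edge v) := by rw [he.range_eq]; exact hx
      exact hf.contraction_edge_one hv hd s
  · right
    refine ⟨n.succ_ne_zero, fun x hx => ?_⟩
    refine contraction_of_forall_ne (notMem x hx) fun v hv hd s hs e => ?_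
    exact h ⟨v, hv, hd, s, hs, e ▸ hx⟩

omit [Group G] [MulAction G X] hf in
lemma contraction_root {r : X} (hr : r ∈ zeroCells X) (h : depth r = 0) (t : I) :
    forestContraction depth edge r t = r := by
  rw [contraction_vertex hr, rootPath_of_depth_eq_zero h]
  rfl

lemma depth_eq_zero_of_contraction {r : X} (hr : r ∈ zeroCells X)
    (h : forestContraction depth edge r 1 = r) : depth r = 0 := by
  rw [contraction_vertex hr] at h
  rw [← h]
  exact (hf.rootPath_one_mem r hr).2

lemma isCellCollapse : IsCellCollapse fun x => forestContraction depth edge x 1 := by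
  intro n i
  rcases hf.cell_cases n i with ⟨-, -, r, hr, hd, h⟩ | ⟨-, h⟩
  · exact Or.inr ⟨r, hr, contraction_root hr hd 1, h⟩
  · exact Or.inl fun x hx => congrArg (fun γ : C(I, X) => γ 1) (h x hx)

/-- The contraction of the forest extends to a homotopy of the whole complex starting at the
identity and preserving all fixed point sets. -/
lemma exists_extension (hX : IsGCWComplex G X) : ∃ Φ : X → C(I, X), Continuous Φ ∧
    ∀ x, Φ x 0 = x ∧
      (∀ H : Subgroup G, x ∈ MulAction.fixedPoints H X → ∀ t, Φ x t ∈ MulAction.fixedPoints H X) ∧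
      (forestContraction depth edge x 1 ∈ zeroCells X → Φ x = forestContraction depth edge x) := by
  obtain ⟨Φ, hΦ, h⟩ := exists_continuousOn_of_cells (univ : Set X)
    (ContinuousMap.const I) (fun x γ => γ 0 = x ∧
      (∀ H : Subgroup G, x ∈ MulAction.fixedPoints H X → ∀ t, γ t ∈ MulAction.fixedPoints H X) ∧
      (forestContraction depth edge x 1 ∈ zeroCells X → γ = forestContraction depth edge x)) (by
    intro n i φ hφ hP
    -- On cells of the forest the extension is forced to be the contraction, which agrees with the
    -- earlier stage on the frontier since its points end at a `0`-cell.
    rcases hf.cell_cases n i with ⟨c, -, r, hr, -, h⟩ | ⟨hn, h⟩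
    · refine ⟨forestContraction depth edge, c, fun x hx => ?_, fun x hx =>
        ⟨hf.contraction_zero x, fun H hH t g => ?_, fun _ => rfl⟩⟩
      · refine ((hP x hx).2.2 ?_).symm
        rw [h x (cellFrontier_subset_closedCell n i hx)]
        exact hr
      · change (g : G) • forestContraction depth edge x t = _
        rw [← hf.contraction_smul hX]
        exact congrArg (fun y => forestContraction depth edge y t) (hH g)
    · obtain ⟨ψ, cψ, eψ, hψ⟩ := exists_path_extension_closedCell i hφ fun x hx => (hP x hx).1
      refine ⟨ψ, cψ, eψ, fun x hx => ?_⟩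
      have hx' := openCell_subset_closedCell n i hx
      refine ⟨(hψ x hx').1, fun H hH t => ?_, fun hmem => ?_⟩
      · have sub : closedCell n i ⊆ MulAction.fixedPoints H X := fun y hy g =>
          hX.smul_eq_of_mem_closedCell (g := (g : G)) hx (hH g) hy
        -- A track stays in the closed cell, which is fixed by `H` with `x`, or follows the track of
        -- a frontier point, which is fixed by `H` by the earlier stage.
        rcases (hψ x hx').2 t with h | ⟨y, hy, s, h⟩
        · exact sub h
        · rw [h]
          exact (hP y hy).2.1 H (sub (cellFrontier_subset_closedCell n i hy)) s
      · rw [h x hx] at hmem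
        exact absurd (eq_zero_of_mem_zeroCells hx hmem) hn)
  exact ⟨Φ, continuousOn_univ.1 hΦ, fun x => h x trivial⟩

end IsRootedForest

end Forest

/-! ### Existence of the forest from the ascending chain condition. -/

section ForestExistence
open RelCWComplex unitInterval

lemma nonempty_cell_zero {X : Type u} [TopologicalSpace X] [T2Space X] {C : Set X} [CWComplex C]
    (hC : C.Nonempty) : Nonempty (cell C 0) := by
  obtain ⟨x, hx⟩ := hC
  obtain ⟨n, i, -⟩ := exists_mem_openCell hx
  induction n using Nat.strong_induction_on with
  | _ n ih =>
    rcases Nat.eq_zero_or_pos n with rfl | hn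
    · exact ⟨i⟩
    · obtain ⟨y, hy⟩ := CWComplex.nonempty_cellFrontier hn.ne' i
      obtain ⟨m, hm, j, -⟩ :=
        mem_skeletonLT_iff_openCell.1 (cellFrontier_subset_skeletonLT n i hy)
      exact ih m hm j

variable (G : Type v) [Group G] {X : Type u} [TopologicalSpace X] [T2Space X] [MulAction G X]
  [CWComplex (univ : Set X)]

lemma exists_mem_openCell_subcomplex {T : Subcomplex (univ : Set X)} {x : X}
    (hx : x ∈ zeroCells X) (hT : x ∈ T) : ∃ i : cell (T : Set X) 0, x ∈ openCell 0 i := by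
  obtain ⟨n, i, hi⟩ := exists_mem_openCell (C := (T : Set X)) hT
  obtain rfl : n = 0 := eq_zero_of_mem_zeroCells (i := i.1) hi hx
  exact ⟨i, hi⟩

/-- There is an edge path from `v` to `w` fixed by the stabilizer of `v`. -/
def IsFixedEdge (v w : X) : Prop :=
  ∃ (η : C(I, X)) (e : cell (univ : Set X) 1), IsEdgePath η e ∧ η 0 = v ∧ η 1 = w ∧
    ∀ g : G, g • v = v → ∀ t, g • η t = η t

/-- The set of points from which `R` can be reached along `n` edges, each of which is fixed by the
stabilizer of its initial vertex. -/
def edgeLevel (R : Set X) : ℕ → Set X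
  | 0 => R
  | n + 1 => {v | ∃ w ∈ edgeLevel R n, IsFixedEdge G v w}

/-- The number of edges needed to reach `R`. -/
noncomputable def edgeDepth (R : Set X) (v : X) : ℕ := sInf {n | v ∈ edgeLevel G R n}

variable {G}

lemma IsFixedEdge.smul (hX : IsGCWComplex G X) {v w : X} (h : IsFixedEdge G v w) (g : G) :
    IsFixedEdge G (g • v) (g • w) := by
  have := hX.continuousConstSMul
  obtain ⟨η, e, hη, rfl, rfl, hfix⟩ := h
  let τ : C(I, X) := ⟨fun t => g • η t, by fun_prop⟩
  obtain ⟨e', he'⟩ := hX.isEdgePath_smul g (τ := τ) hη fun t => rfl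
  refine ⟨τ, e', he', rfl, rfl, fun k hk t => ?_⟩
  have := hfix (g⁻¹ * k * g) (by rw [mul_smul, mul_smul, hk, inv_smul_smul]) t
  change k • g • η t = g • η t
  rwa [mul_smul, mul_smul, inv_smul_eq_iff] at this

lemma smul_mem_edgeLevel (hX : IsGCWComplex G X) {R : Set X} (hR : ∀ r ∈ R, ∀ g : G, g • r ∈ R)
    (n : ℕ) {v : X} (hv : v ∈ edgeLevel G R n) (g : G) : g • v ∈ edgeLevel G R n := by
  induction n generalizing v with
  | zero => exact hR v hv g
  | succ n ih =>
    obtain ⟨w, hw, hvw⟩ := hv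
    exact ⟨_, ih hw, hvw.smul hX g⟩

lemma edgeDepth_smul (hX : IsGCWComplex G X) {R : Set X} (hR : ∀ r ∈ R, ∀ g : G, g • r ∈ R)
    (v : X) (g : G) : edgeDepth G R (g • v) = edgeDepth G R v := by
  have : {n | g • v ∈ edgeLevel G R n} = {n | v ∈ edgeLevel G R n} := by
    ext n
    exact ⟨fun h => by simpa using smul_mem_edgeLevel hX hR n h g⁻¹,
      fun h => smul_mem_edgeLevel hX hR n h g⟩
  rw [edgeDepth, this, edgeDepth]

/-- By the ascending chain condition, every vertex reaches `R`, as soon as `R` meets all fixed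
point sets of members of `F`. -/
lemma exists_mem_edgeLevel {F : Set (Subgroup G)} (hX : IsModelEFG F X) (hacc : WellFoundedGT F)
    {R : Set X} (hRV : R ⊆ zeroCells X) (hR : ∀ H ∈ F, ∃ r ∈ R, r ∈ MulAction.fixedPoints H X)
    (v : X) (hv : v ∈ zeroCells X) : ∃ n, v ∈ edgeLevel G R n := by
  suffices ∀ H : F, ∀ v ∈ zeroCells X, MulAction.stabilizer G v = H → ∃ n, v ∈ edgeLevel G R n from
    this ⟨_, hX.stabilizer_mem v⟩ v hv rfl
  intro H
  induction H using hacc.induction with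
  | ind H ih =>
    intro v hv hvH
    obtain ⟨T, hT⟩ := hX.isGCWComplex.exists_subcomplex_fixedPoints H.1
    have memT {x : X} : x ∈ T ↔ ∀ g ∈ H.1, g • x = x := by
      rw [← SetLike.mem_coe, hT]
      exact ⟨fun h g hg => h ⟨g, hg⟩, fun h g => h g.1 g.2⟩
    have conn : IsPreconnected (T : Set X) := by
      rw [hT]
      have := hX.contractible_fixedPoints H.1 H.2
      exact isPreconnected_iff_preconnectedSpace.2 inferInstance
    obtain ⟨r, hr, hrT⟩ := hR H.1 H.2
    have hvT : v ∈ T := memT.2 fun g hg => by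
      rw [← hvH] at hg
      exact hg
    obtain ⟨i, hi⟩ := exists_mem_openCell_subcomplex (hRV hr) (hT ▸ hrT : r ∈ (T : Set X))
    obtain ⟨j, hj⟩ := exists_mem_openCell_subcomplex hv hvT
    -- In the connected complex `X^H` it suffices that reaching `R` passes from one end of an edge
    -- to the other, starting from the point `r` of `R` in `X^H`.
    refine CWComplex.mem_of_isPreconnected (T : Set X) conn {w | ∃ n, w ∈ edgeLevel G R n} ?_ hi hj
      ⟨0, hr⟩
    rintro e x hx y hy ⟨n, hn⟩
    rcases eq_or_ne x y with rfl | hxy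
    · exact ⟨n, hn⟩
    obtain ⟨η, hη, rfl, rfl⟩ := exists_isEdgePath (e.1 : cell (univ : Set X) 1) hy hx hxy.symm
    have mem (t : I) : η t ∈ T := by
      refine Subcomplex.closedCell_subset_of_mem T e.2 ?_
      rw [← hη.range_eq]
      exact mem_range_self t
    have hle : H.1 ≤ MulAction.stabilizer G (η 0) := fun g hg => memT.1 (mem 0) g hg
    -- If the new vertex has isotropy group exactly `H`, the edge lies in `X^H` and prolongs the
    -- chain. If the group is larger, the induction hypothesis gives a chain that may leave `X^H`.
    rcases hle.eq_or_lt with heq | hlt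
    · refine ⟨n + 1, η 1, hn, η, e.1, hη, rfl, rfl, fun g hg t => memT.1 (mem t) g ?_⟩
      rw [heq]
      exact hg
    · exact ih ⟨_, hX.stabilizer_mem (η 0)⟩ hlt _ hη.apply_mem_zeroCells.1 rfl

-- The first edge of a shortest chain leads to a vertex of depth exactly one less: a shorter chain
-- from there would shorten the original one.
omit [T2Space X] in
lemma exists_isEdgePath_of_edgeDepth {R : Set X} {v : X} (hv : ∃ n, v ∈ edgeLevel G R n)
    (hd : edgeDepth G R v ≠ 0) : ∃ η : C(I, X), (∃ e, IsEdgePath η e) ∧ η 0 = v ∧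
      edgeDepth G R (η 1) + 1 = edgeDepth G R v ∧ ∀ g : G, g • v = v → ∀ t, g • η t = η t := by
  have mem : v ∈ edgeLevel G R (edgeDepth G R v) := Nat.sInf_mem hv
  obtain ⟨n, hn⟩ := Nat.exists_eq_succ_of_ne_zero hd
  rw [hn] at mem
  obtain ⟨_, hw, η, e, hη, h0, rfl, hfix⟩ := mem
  refine ⟨η, ⟨e, hη⟩, h0, ?_, hfix⟩
  have h₁ : edgeDepth G R (η 1) ≤ n := Nat.sInf_le hw
  have h₂ : η 1 ∈ edgeLevel G R (edgeDepth G R (η 1)) :=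
    Nat.sInf_mem (s := {n | η 1 ∈ edgeLevel G R n}) ⟨n, hw⟩
  have h₃ : edgeDepth G R v ≤ edgeDepth G R (η 1) + 1 :=
    Nat.sInf_le ⟨_, h₂, η, e, hη, h0, rfl, hfix⟩
  omega

/-- Edges are chosen at one representative of each orbit and translated. The translate does not
depend on the group element used, because the edge is fixed by the isotropy group of its initial
vertex. -/
lemma exists_isRootedForest (hX : IsGCWComplex G X) {R : Set X}
    (hR : ∀ r ∈ R, ∀ g : G, g • r ∈ R)
    (hreach : ∀ v ∈ zeroCells X, ∃ n, v ∈ edgeLevel G R n) :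
    ∃ edge : X → C(I, X), IsRootedForest G (edgeDepth G R) edge := by
  classical
  have := hX.continuousConstSMul
  have ex (v : X) : ∃ η : C(I, X), v ∈ zeroCells X → edgeDepth G R v ≠ 0 →
      (∃ e, IsEdgePath η e) ∧ η 0 = v ∧
      edgeDepth G R (η 1) + 1 = edgeDepth G R v ∧ ∀ g : G, g • v = v → ∀ t, g • η t = η t := by
    by_cases h : v ∈ zeroCells X ∧ edgeDepth G R v ≠ 0
    · obtain ⟨η, hη⟩ := exists_isEdgePath_of_edgeDepth (hreach v h.1) h.2
      exact ⟨η, fun _ _ => hη⟩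
    · exact ⟨ContinuousMap.const I v, fun h₁ h₂ => absurd ⟨h₁, h₂⟩ h⟩
  choose ε hε using ex
  let rep (v : X) : X := (Quotient.mk (MulAction.orbitRel G X) v).out
  have rep_smul (g : G) (v : X) : rep (g • v) = rep v :=
    congrArg Quotient.out (Quotient.sound (s := MulAction.orbitRel G X) ⟨g, rfl⟩)
  have exτ (v : X) : ∃ g : G, g • rep v = v := by
    have : (MulAction.orbitRel G X) v (rep v) :=
      (MulAction.orbitRel G X).symm (Quotient.mk_out (s := MulAction.orbitRel G X) v)
    exact this
  choose τ hτ using exτ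
  have repV {v : X} (hv : v ∈ zeroCells X) : rep v ∈ zeroCells X := by
    rw [← hX.smul_mem_zeroCells_iff (τ v), hτ]
    exact hv
  have repd (v : X) : edgeDepth G R (rep v) = edgeDepth G R v := by
    rw [← edgeDepth_smul hX hR _ (τ v), hτ]
  let edge (v : X) : C(I, X) := ⟨fun t => τ v • ε (rep v) t, by fun_prop⟩
  have spec {v : X} (hv : v ∈ zeroCells X) (hd : edgeDepth G R v ≠ 0) :=
    hε (rep v) (repV hv) (by rwa [repd])
  refine ⟨edge, ⟨fun v hv hd => ?_, fun v hv hd => ?_, fun v hv hd => ?_,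
    fun v _ g => edgeDepth_smul hX hR v g, fun v hv hd g t => ?_⟩⟩
  · obtain ⟨e, he⟩ := (spec hv hd).1
    exact hX.isEdgePath_smul (τ v) he fun t => rfl
  · change τ v • ε (rep v) 0 = v
    rw [(spec hv hd).2.1, hτ]
  · change edgeDepth G R (τ v • ε (rep v) 1) + 1 = _
    rw [edgeDepth_smul hX hR, (spec hv hd).2.2.1, repd]
  · change τ (g • v) • ε (rep (g • v)) t = g • τ v • ε (rep v) t
    rw [rep_smul]
    -- The two ways of translating the edge to `g • v` differ by this element of the isotropy group
    -- of the representative.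
    have fix : ((τ (g • v))⁻¹ * g * τ v) • rep v = rep v := by
      rw [mul_smul, mul_smul, hτ, inv_smul_eq_iff]
      conv_rhs => rw [← rep_smul g v, hτ]
    have := (spec hv hd).2.2.2 _ fix t
    rw [mul_smul, mul_smul, inv_smul_eq_iff] at this
    exact this.symm

end ForestExistence

/-! ### Families of subgroups and their maximal members. -/

section Families

variable {G : Type v} [Group G]

/-- The subgroups subconjugate to members of `P` already form a family containing `P`. -/
lemma exists_le_conj_of_mem_generatedFamily {P : Set (Subgroup G)} {H : Subgroup G}
    (hH : H ∈ generatedFamily P) :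
    ∃ M ∈ P, ∃ g : G, H ≤ M.map (MulAut.conj g).toMonoidHom := by
  refine hH {H | ∃ M ∈ P, ∃ g : G, H ≤ M.map (MulAut.conj g).toMonoidHom} ⟨⟨?_, ?_⟩, ?_⟩
  · rintro H ⟨M, hM, g, h⟩ k
    refine ⟨M, hM, k * g, ?_⟩
    rintro _ ⟨x, hx, rfl⟩
    obtain ⟨m, hm, rfl⟩ := h hx
    exact ⟨m, hm, by simp [mul_assoc]⟩
  · rintro H ⟨M, hM, g, h⟩ K hK
    exact ⟨M, hM, g, hK.trans h⟩
  · intro M hM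
    exact ⟨M, hM, 1, fun m hm => ⟨m, hm, by simp⟩⟩

lemma Maximal.stabilizer_smul {X : Type u} [MulAction G X] {F : Set (Subgroup G)}
    (hF : IsSubgroupFamily F) {x : X} (h : Maximal (· ∈ F) (MulAction.stabilizer G x)) (g : G) :
    Maximal (· ∈ F) (MulAction.stabilizer G (g • x)) := by
  rw [MulAction.stabilizer_smul_eq_stabilizer_map_conj]
  refine ⟨hF.conj_mem _ h.1 g, fun K hK hle k hk => ?_⟩
  have hle' : MulAction.stabilizer G x ≤ K.map (MulAut.conj g⁻¹).toMonoidHom := fun m hm =>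
    ⟨g * m * g⁻¹, hle ⟨m, hm, by simp⟩, by simp [mul_assoc]⟩
  have := h.2 (hF.conj_mem K hK g⁻¹) hle' ⟨k, hk, rfl⟩
  exact ⟨_, this, by simp [mul_assoc]⟩

/-- A maximal member of the family is the isotropy group of a `0`-cell. -/
lemma IsModelEFG.exists_stabilizer_eq {F : Set (Subgroup G)} {X : Type u} [TopologicalSpace X]
    [T2Space X] [MulAction G X] [CWComplex (univ : Set X)] (hX : IsModelEFG F X) {M : Subgroup G}
    (hM : Maximal (· ∈ F) M) : ∃ v ∈ zeroCells X, MulAction.stabilizer G v = M := by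
  obtain ⟨T, hT⟩ := hX.isGCWComplex.exists_subcomplex_fixedPoints M
  have := hX.contractible_fixedPoints M hM.1
  have ne : (T : Set X).Nonempty := by
    rw [hT]
    exact nonempty_coe_sort.1 inferInstance
  obtain ⟨i⟩ := nonempty_cell_zero ne
  obtain ⟨v, hv⟩ := RelCWComplex.openCell_nonempty 0 i
  have hvT : v ∈ MulAction.fixedPoints M X :=
    hT ▸ RelCWComplex.openCell_subset_complex (C := (T : Set X)) 0 i hv
  refine ⟨v, mem_zeroCells.2 ⟨i.1, hv⟩, ?_⟩
  -- The isotropy group of any point of `X^M` contains `M` and lies in `F`, so maximality makes it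
  -- equal to `M`.
  have hle : M ≤ MulAction.stabilizer G v := fun g hg => hvT ⟨g, hg⟩
  exact le_antisymm (hM.2 (hX.stabilizer_mem v) hle) hle

end Families

/-! ### The main theorem. -/

theorem mainTheorem3 {G : Type v} [Group G] (F : Set (Subgroup G)) (hF : IsSubgroupFamily F)
    (X : Type u) [TopologicalSpace X] [T2Space X] [MulAction G X]
    [CWComplex (univ : Set X)] (hX : IsModelEFG F X)
    (hgen : ∃ P : Set (Subgroup G), P.Finite ∧ (∀ H ∈ P, Maximal (· ∈ F) H) ∧
      F = generatedFamily P)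
    (hacc : WellFoundedGT F) :
    ∃ (Y : Type u) (_ : TopologicalSpace Y) (_ : T2Space Y) (_ : MulAction G Y)
      (_ : CWComplex (univ : Set Y)) (f : X → Y),
      IsGCWComplex G Y ∧
      -- `f` is a `G`-equivariant quotient map
      (IsQuotientMap f ∧ ∀ (g : G) (x : X), f (g • x) = g • f x) ∧
      -- the `0`-skeleton of `Y` has finitely many `G`-orbits
      ((MulAction.orbit G : Y → Set Y) '' zeroCells Y).Finite ∧
      -- the isotropy of every `0`-cell is maximal in `F`, and all isotropy groups lie in `F`
      (∀ y ∈ zeroCells Y, Maximal (· ∈ F) (MulAction.stabilizer G y)) ∧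
      (∀ y : Y, MulAction.stabilizer G y ∈ F) ∧
      -- the preimage of every `0`-cell is a contractible subcomplex of the `1`-skeleton of `X`
      (∀ y ∈ zeroCells Y, ContractibleSpace (f ⁻¹' {y}) ∧
        ∃ T : RelCWComplex.Subcomplex (univ : Set X),
          (T : Set X) = f ⁻¹' {y} ∧ T ≤ RelCWComplex.skeleton (univ : Set X) 1) ∧
      -- for `k > 1`, every open `k`-cell of `X` maps homeomorphically onto an open `k`-cell of `Y`
      (∀ k : ℕ, 1 < k → ∀ i : RelCWComplex.cell (univ : Set X) k,
        ∃ j : RelCWComplex.cell (univ : Set Y) k,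
          f '' RelCWComplex.openCell k i = RelCWComplex.openCell k j ∧
          IsEmbedding ((RelCWComplex.openCell k i).domRestrict f)) ∧
      -- for `H ∈ F`, `f` restricts to a homotopy equivalence from `X^H` to `Y^H`
      (∀ H ∈ F, ∃ e : ContinuousMap.HomotopyEquiv (MulAction.fixedPoints H X)
          (MulAction.fixedPoints H Y),
        ∀ x : MulAction.fixedPoints H X, (e x : Y) = f x) := by

  obtain ⟨P, hP, hPmax, hFP⟩ := hgen
  have exv (M : P) : ∃ v ∈ zeroCells X, MulAction.stabilizer G v = M :=
    hX.exists_stabilizer_eq (hPmax M M.2)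
  choose v hv hvM using exv
  let R : Set X := {x | ∃ M, ∃ g : G, g • v M = x}
  have hRV : R ⊆ zeroCells X := by
    rintro _ ⟨M, g, rfl⟩
    exact hX.isGCWComplex.smul_mem_zeroCells g (hv M)
  have hRG : ∀ r ∈ R, ∀ g : G, g • r ∈ R := by
    rintro _ ⟨M, k, rfl⟩ g
    exact ⟨M, g * k, mul_smul _ _ _⟩
  have hRH : ∀ H ∈ F, ∃ r ∈ R, r ∈ MulAction.fixedPoints H X := by
    intro H hH
    rw [hFP] at hH
    obtain ⟨M, hM, g, hle⟩ := exists_le_conj_of_mem_generatedFamily hH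
    -- The isotropy group of this translate is the conjugate of `M` by `g`, which contains `H`.
    refine ⟨g • v ⟨M, hM⟩, ⟨_, g, rfl⟩, fun h => ?_⟩
    have := hle h.2
    have e : M = MulAction.stabilizer G (v ⟨M, hM⟩) := (hvM ⟨M, hM⟩).symm
    rw [e, ← MulAction.stabilizer_smul_eq_stabilizer_map_conj] at this
    exact this
  have hreach := exists_mem_edgeLevel hX hacc hRV hRH
  obtain ⟨edge, hf⟩ := exists_isRootedForest hX.isGCWComplex hRG hreach
  have root_mem : ∀ r ∈ zeroCells X, forestContraction (edgeDepth G R) edge r 1 = r → r ∈ R := by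
    intro r hr h
    have h0 : edgeDepth G R r = 0 := hf.depth_eq_zero_of_contraction hr h
    -- Since `sInf ∅ = 0`, depth `0` alone does not put `r` in `R`; reachability of `r` is needed
    -- here.
    have : r ∈ edgeLevel G R (edgeDepth G R r) := Nat.sInf_mem (hreach r hr)
    rwa [h0] at this
  obtain ⟨Φ, hΦ, h⟩ := hf.exists_extension hX.isGCWComplex
  refine exists_quotient_of_collapse F X hX hf.isCellCollapse (fun n hn i x hx => ?_)
    (fun g x => hf.contraction_smul hX.isGCWComplex g x 1) ?_ ?_ hΦ (fun x => (h x).1)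
    (fun x hx => ?_) (fun H x hx t => (h x).2.1 H hx t)
  · rcases hf.cell_cases n i with ⟨-, hn', -⟩ | ⟨-, h⟩
    · omega
    · rw [h x hx]
      rfl
  · have : Finite P := hP
    refine (finite_range fun M => MulAction.orbit G (v M)).subset ?_
    rintro _ ⟨r, ⟨hr, hqr⟩, rfl⟩
    obtain ⟨M, g, rfl⟩ := root_mem r hr hqr
    exact ⟨M, (MulAction.orbit_smul g (v M)).symm⟩
  · intro r hr hqr
    obtain ⟨M, g, rfl⟩ := root_mem r hr hqr
    refine Maximal.stabilizer_smul hF ?_ g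
    rw [hvM]
    exact hPmax M M.2
  · rw [(h x).2.2 hx]
    exact ⟨rfl, hf.contraction_contraction x⟩
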